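/- Let $G$ be a (discrete) group and let $L^2(G)$ be the Hilbert space of square-summable formal sums $\sum_{g\in G}\lambda_g\, g$, $\lambda_g\in\mathbb{C}$. An $(r,s)$-matrix $A=(a_{k,j})$ over $\mathbb{Z}G$ defines a bounded $G$-equivariant operator $r_A^{(2)}\colon L^2(G)^r\to L^2(G)^s$, $(x_k)_k\mapsto\bigl(\sum_{k} x_k a_{k,j}\bigr)_j$. For a bounded $G$-equivariant operator $f\colon L^2(G)^r\to L^2(G)^s$ let $F_f(\lambda)=\dim_{\mathcal{N}(G)}\bigl(\operatorname{im} E^{f^*f}_{\lambda^2}\bigr)$ for $\lambda\ge 0$ and $F_f(\lambda)=0$ for $\lambda<0$ be its spectral density function, where $(E^{f^*f}_{\mu})_{\mu}$ is the right-continuous family of spectral projections of $f^*f$ and $\dim_{\mathcal{N}(G)}(V)=\sum_{i=1}^r\langle p_V(e_i),e_i\rangle$ for a closed $G$-invariant subspace $V\subseteq L^2(G)^r$ with orthogonal projection $p_V$, and $e_i\in L^2(G)^r$ has the unit element of $G$ as its $i$-th entry and $0$ elsewhere. The Fuglede--Kadison determinant is $\det_{\mathcal{N}(G)}(f)=\exp\bigl(\int_{0+}^{\infty}\ln(\lambda)\,dF_f(\lambda)\bigr)$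 if the integral converges to a real number, and $0$ otherwise. A bounded $G$-equivariant operator is a weak isomorphism if it is injective with dense image. Let $\Lambda(G)$ be the infimum of all values $\det_{\mathcal{N}(G)}(r_A^{(2)})>1$, where $A$ runs through the $(r,s)$-matrices over $\mathbb{Z}G$ for all $r,s\ge1$. Let $\Lambda_1(G)$ be the infimum of these values if only $(1,1)$-matrices are allowed, $\Lambda^w(G)$ if only $(r,r)$-matrices, $r\ge 1$, for which $r_A^{(2)}$ is a weak isomorphism are allowed, and $\Lambda_1^w(G)$ if only $(1,1)$-matrices for which $r_A^{(2)}$ is a weak isomorphism are allowed. Then the following holds. 1. If $H$ is a subgroup of $G$, then $\Lambda(G)\le\Lambda(H)$, $\Lambda_1(G)\le\Lambda_1(H)$, $\Lambda^w(G)\le\Lambda^w(H)$ and $\Lambda_1^w(G)\le\Lambda_1^w(H)$. 2. If $H\subseteq G$ is a subgroup of finite index, then $\Lambda(H)^{1/[G:H]}\le\Lambda(G)$ and $\Lambda^w(H)^{1/[G:H]}\le\Lambda^w(G)$. 3. $\Lambda_1(\{1\})=\Lambda^w(\{1\})=\Lambda_1^w(\{1\})=2$ and $\Lambda(\{1\})=\sqrt2$;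 moreover $\Lambda^w(\mathbb{Z}/2)=\Lambda_1^w(\mathbb{Z}/2)=\sqrt3$, $\Lambda_1(\mathbb{Z}/2)=\sqrt2$ and $2^{1/4}\le\Lambda(\mathbb{Z}/2)\le\sqrt2$. 4. If $G$ is finite and $|G|\ge3$, then $$2^{1/|G|}\le\Lambda^w(G)\le\Lambda_1^w(G)\le(|G|-1)^{1/|G|},\qquad 2^{1/(2|G|)}\le\Lambda(G)\le\Lambda_1(G)\le(|G|-1)^{1/|G|}.$$ 5. For every group $G$, $$\Lambda(G)=\inf_H\Lambda(H),\quad \Lambda_1(G)=\inf_H\Lambda_1(H),\quad \Lambda^w(G)=\inf_H\Lambda^w(H),\quad \Lambda_1^w(G)=\inf_H\Lambda_1^w(H),$$ where $H$ runs through the finitely generated subgroups of $G$. -/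

import Mathlib

open MeasureTheory Filter Topology
open scoped ENNReal InnerProductSpace

universe u

noncomputable section

namespace Lehmer

/-! ### The Hilbert spaces `L²(G)` and `L²(G)^r` -/

/-- `L²(G)`: square summable functions `G → ℂ`; `x` stands for the formal sum `∑ x(g) · g`. -/
abbrev L2 (G : Type u) : Type u := lp (fun _ : G => ℂ) 2

/-- `L²(G)^r`, the Hilbert space direct sum of `r` copies of `L²(G)`. -/
abbrev L2Pow (G : Type u) (r : ℕ) : Type u := PiLp 2 (fun _ : Fin r => L2 G)

variable {G : Type u} [Group G]

/-! ### Right multiplication with matrices over the integral group ring -/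

lemma memℓp_translate (g : G) (x : L2 G) : Memℓp (fun h : G => x (h * g⁻¹)) 2 := by
  have hx := (lp.memℓp x).summable (by norm_num)
  exact memℓp_gen ((Equiv.mulRight g⁻¹).summable_iff.mpr hx)

/-- Right multiplication `x ↦ x · g` on `L²(G)`. As `(∑ x(k) · k) · g = ∑ x(k) · kg`, the
coefficient of `x · g` at `h` is `x(h g⁻¹)`. -/
def rightTranslate (g : G) : L2 G →ₗᵢ[ℂ] L2 G where
  toFun x := ⟨fun h => x (h * g⁻¹), memℓp_translate g x⟩
  map_add' x y := by ext h; rfl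
  map_smul' c x := by ext h; rfl
  norm_map' x := by
    have h2 : 0 < (2 : ℝ≥0∞).toReal := by norm_num
    rw [lp.norm_eq_tsum_rpow h2, lp.norm_eq_tsum_rpow h2]
    congr 1
    exact (Equiv.mulRight g⁻¹).tsum_eq (fun h => ‖x h‖ ^ (2 : ℝ≥0∞).toReal)

/-- Right multiplication `x ↦ x · a` on `L²(G)` with `a = ∑ n_g · g` in `ℤG`. -/
def rightMul (a : MonoidAlgebra ℤ G) : L2 G →L[ℂ] L2 G :=
  a.coeff.sum fun g n => (n : ℂ) • (rightTranslate g).toContinuousLinearMap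

/-- The operator `r_A^{(2)} : L²(G)^r → L²(G)^s`,
`(x_k)_k ↦ (∑_k x_k · a_{k,j})_j`, of an `(r,s)`-matrix `A` over `ℤG`. -/
def rightMulMatrix {r s : ℕ} (A : Matrix (Fin r) (Fin s) (MonoidAlgebra ℤ G)) :
    L2Pow G r →L[ℂ] L2Pow G s :=
  (PiLp.continuousLinearEquiv 2 ℂ (fun _ : Fin s => L2 G)).symm.toContinuousLinearMap ∘L
    ContinuousLinearMap.pi fun j =>
      ∑ k, rightMul (A k j) ∘L PiLp.proj 2 (fun _ : Fin r => L2 G) k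

/-- A weak isomorphism: an injective bounded operator with dense image. -/
def IsWeakIso {r s : ℕ} (f : L2Pow G r →L[ℂ] L2Pow G s) : Prop :=
  Function.Injective f ∧ DenseRange f

/-! ### Von Neumann trace and dimension -/

/-- The vector of `L²(G)^r` with the unit element `e ∈ G ⊆ L²(G)` in position `i`, and `0`
elsewhere. -/
def unitVec (G : Type u) [Group G] (r : ℕ) (i : Fin r) : L2Pow G r :=
  open scoped Classical in PiLp.single 2 i (lp.single 2 (1 : G) (1 : ℂ))

/-- The von Neumann trace of an operator on `L²(G)^r`, i.e. the sum over the diagonal entries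
`a_{i,i}` of its matrix of `⟨a_{i,i}(e), e⟩`. (Mathlib's inner product is conjugate linear in the
first variable.) -/
def vnTrace {r : ℕ} (f : L2Pow G r →L[ℂ] L2Pow G r) : ℂ :=
  ∑ i, ⟪unitVec G r i, f (unitVec G r i)⟫_ℂ

/-- The von Neumann dimension of a closed (`G`-invariant) subspace of `L²(G)^r`: the von Neumann
trace of the orthogonal projection onto it. This trace is a nonnegative real number. -/
def vnDim {r : ℕ} (V : Submodule ℂ (L2Pow G r)) [V.HasOrthogonalProjection] : ℝ :=
  (vnTrace V.starProjection).re

/-! ### Spectral projections -/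

section Spectral

variable {E : Type*} [NormedAddCommGroup E] [InnerProductSpace ℂ E] [CompleteSpace E]

/-- The image of the spectral projection `E_μ^T` (the projection belonging to `(-∞, μ]`) of a
bounded selfadjoint operator `T`: the kernel of the positive part `(T - μ)₊`. -/
def spectralSubspace (T : E →L[ℂ] E) (μ : ℝ) : Submodule ℂ E :=
  (cfc (fun t : ℝ => max (t - μ) 0) T).ker

instance (T : E →L[ℂ] E) (μ : ℝ) : (spectralSubspace T μ).HasOrthogonalProjection :=
  inferInstanceAs (cfc (fun t : ℝ => max (t - μ) 0) T).ker.HasOrthogonalProjection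

lemma spectralSubspace_mono (T : E →L[ℂ] E) : Monotone (spectralSubspace T) := by
  intro μ ν h
  rcases h.eq_or_lt with rfl | hlt
  · exact le_rfl
  have hne : ∀ t : ℝ, max (t - μ) (ν - μ) ≠ 0 := fun t =>
    (lt_of_lt_of_le (sub_pos.2 hlt) (le_max_right _ _)).ne'
  have hc : Continuous fun t : ℝ => max (t - ν) 0 / max (t - μ) (ν - μ) := by
    refine Continuous.div (by fun_prop) (by fun_prop) hne
  have key : cfc (fun t : ℝ => max (t - ν) 0) T =
      cfc (fun t : ℝ => max (t - ν) 0 / max (t - μ) (ν - μ)) T *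
        cfc (fun t : ℝ => max (t - μ) 0) T := by
    rw [← cfc_mul _ _ T hc.continuousOn (by fun_prop)]
    congr 1
    funext t
    rcases le_total t ν with ht | ht
    · simp [max_eq_right (sub_nonpos.2 ht)]
    · have h1 : max (t - μ) (ν - μ) = t - μ := max_eq_left (by linarith)
      have h2 : max (t - μ) 0 = t - μ := max_eq_left (by linarith)
      have h3 : t - μ ≠ 0 := by linarith
      rw [h1, h2, div_mul_cancel₀ _ h3]
  intro v hv
  have hv' : cfc (fun t : ℝ => max (t - μ) 0) T v = 0 := hv
  change cfc (fun t : ℝ => max (t - ν) 0) T v = 0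
  rw [key, mul_apply_eq_comp, hv', map_zero]

lemma iInf_spectralSubspace (T : E →L[ℂ] E) (μ : ℝ) :
    ⨅ ν : Set.Ioi μ, spectralSubspace T ν = spectralSubspace T μ := by
  refine le_antisymm (fun v hv => ?_) (le_iInf fun ν => spectralSubspace_mono T ν.2.le)
  rw [Submodule.mem_iInf] at hv
  change cfc (fun t : ℝ => max (t - μ) 0) T v = 0
  rw [← norm_le_zero_iff]
  refine le_of_forall_pos_le_add fun ε hε => ?_
  have hd : 0 < ε / (‖v‖ + 1) := by positivity
  set ν := μ + ε / (‖v‖ + 1) with hν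
  have h0 : cfc (fun t : ℝ => max (t - ν) 0) T v = 0 := hv ⟨ν, by simp [hν, hd]⟩
  have hb : ‖cfc (fun t : ℝ => max (t - μ) 0) T - cfc (fun t : ℝ => max (t - ν) 0) T‖ ≤
      ε / (‖v‖ + 1) := by
    rw [← cfc_sub _ _ T (by fun_prop) (by fun_prop)]
    refine norm_cfc_le hd.le fun t _ => ?_
    refine (abs_max_sub_max_le_abs _ _ _).trans ?_
    rw [show t - μ - (t - ν) = ε / (‖v‖ + 1) by rw [hν]; ring, abs_of_pos hd]
  have h1 : cfc (fun t : ℝ => max (t - μ) 0) T v =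
      (cfc (fun t : ℝ => max (t - μ) 0) T - cfc (fun t : ℝ => max (t - ν) 0) T) v := by
    rw [sub_apply, h0, sub_zero]
  rw [h1, zero_add]
  calc _ ≤ ε / (‖v‖ + 1) * ‖v‖ := ContinuousLinearMap.le_of_opNorm_le _ hb v
    _ ≤ ε / (‖v‖ + 1) * (‖v‖ + 1) := by gcongr; linarith
    _ = ε := by field_simp

lemma tendsto_spectralProjection (T : E →L[ℂ] E) (μ : ℝ) (v : E) :
    Tendsto (fun ν => (spectralSubspace T ν).starProjection v) (𝓝[≥] μ)
      (𝓝 ((spectralSubspace T μ).starProjection v)) := by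
  suffices h : Tendsto (fun ν => (spectralSubspace T ν).starProjection v) (𝓝[>] μ)
      (𝓝 ((spectralSubspace T μ).starProjection v)) from
    continuousWithinAt_Ioi_iff_Ici.1 h
  have hm : Monotone fun ν : (Set.Ioi μ)ᵒᵈ => (spectralSubspace T ((OrderDual.ofDual ν : Set.Ioi μ) : ℝ))ᗮ :=
    fun a b hab => Submodule.orthogonal_le (spectralSubspace_mono T hab)
  have hU := Submodule.starProjection_tendsto_closure_iSup _ hm v
  have hcl : (⨆ ν : (Set.Ioi μ)ᵒᵈ,
      (spectralSubspace T ((OrderDual.ofDual ν : Set.Ioi μ) : ℝ))ᗮ).topologicalClosure =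
        (spectralSubspace T μ)ᗮ := by
    rw [← Submodule.orthogonal_orthogonal_eq_closure, ← Submodule.iInf_orthogonal]
    simp_rw [Submodule.orthogonal_orthogonal]
    rw [← iInf_spectralSubspace T μ]
    rfl
  simp_rw [hcl, Submodule.starProjection_orthogonal_val] at hU
  have hU2 := hU.const_sub v
  simp only [sub_sub_cancel] at hU2
  rw [← map_coe_Ioi_atBot μ, tendsto_map'_iff]
  exact hU2

end Spectral

lemma re_inner_starProjection {E : Type*} [NormedAddCommGroup E] [InnerProductSpace ℂ E]
    (V : Submodule ℂ E) [V.HasOrthogonalProjection] (v : E) :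
    (⟪v, V.starProjection v⟫_ℂ).re = ‖V.starProjection v‖ ^ 2 := by
  have h : (⟪V.starProjection v, v⟫_ℂ).re = ‖V.orthogonalProjectionOnto v‖ ^ 2 :=
    V.re_inner_starProjection_eq_normSq v
  rw [← inner_conj_symm, Complex.conj_re, h]
  rfl

/-! ### The Fuglede-Kadison determinant -/

/-- The spectral density function of `f : L²(G)^r → L²(G)^s`: it sends `t ≥ 0` to the von Neumann
dimension of the image of the spectral projection `E_{t²}^{f*f}`; it is extended by `0` to
`t < 0`. -/
def spectralDensity {r s : ℕ} (f : L2Pow G r →L[ℂ] L2Pow G s) (t : ℝ) : ℝ :=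
  if 0 ≤ t then vnDim (spectralSubspace (f.adjoint ∘L f) (t ^ 2)) else 0

lemma vnDim_eq {r : ℕ} (V : Submodule ℂ (L2Pow G r)) [V.HasOrthogonalProjection] :
    vnDim V = ∑ i, ‖V.starProjection (unitVec G r i)‖ ^ 2 := by
  simp only [vnDim, vnTrace, Complex.re_sum]
  refine Finset.sum_congr rfl fun i _ => ?_
  exact re_inner_starProjection V (unitVec G r i)

lemma vnDim_nonneg {r : ℕ} (V : Submodule ℂ (L2Pow G r)) [V.HasOrthogonalProjection] :
    0 ≤ vnDim V := by
  rw [vnDim_eq]; positivity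

lemma vnDim_mono {r : ℕ} {V W : Submodule ℂ (L2Pow G r)} [V.HasOrthogonalProjection]
    [W.HasOrthogonalProjection] (h : V ≤ W) : vnDim V ≤ vnDim W := by
  rw [vnDim_eq, vnDim_eq]
  refine Finset.sum_le_sum fun i _ => ?_
  gcongr
  have : V.starProjection (unitVec G r i) =
      V.starProjection (W.starProjection (unitVec G r i)) := by
    rw [Submodule.starProjection_apply, Submodule.starProjection_apply,
      Submodule.orthogonalProjectionOnto_starProjection_of_le h]
  rw [this]
  exact V.norm_starProjection_apply_le _

lemma spectralDensity_mono {r s : ℕ} (f : L2Pow G r →L[ℂ] L2Pow G s) :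
    Monotone (spectralDensity f) := by
  intro a b hab
  unfold spectralDensity
  split_ifs with ha hb hb
  · exact vnDim_mono (spectralSubspace_mono _ (by gcongr))
  · exact absurd (ha.trans hab) hb
  · exact vnDim_nonneg _
  · exact le_rfl

lemma spectralDensity_rightCont {r s : ℕ} (f : L2Pow G r →L[ℂ] L2Pow G s) (x : ℝ) :
    ContinuousWithinAt (spectralDensity f) (Set.Ici x) x := by
  rcases lt_or_ge x 0 with hx | hx
  · refine ContinuousAt.continuousWithinAt ?_
    refine (continuousAt_const (y := (0 : ℝ))).congr ?_
    filter_upwards [Iio_mem_nhds hx] with t ht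
    exact (if_neg (not_le.2 ht)).symm
  · have hsq : Tendsto (fun t : ℝ => t ^ 2) (𝓝[≥] x) (𝓝[≥] (x ^ 2)) := by
      refine tendsto_nhdsWithin_iff.2 ⟨?_, ?_⟩
      · exact ((continuous_pow 2).tendsto x).mono_left nhdsWithin_le_nhds
      · filter_upwards [self_mem_nhdsWithin] with t ht
        have : x ≤ t := ht
        exact Set.mem_Ici.2 (by gcongr)
    have hmain : ContinuousWithinAt
        (fun t : ℝ => vnDim (spectralSubspace (f.adjoint ∘L f) (t ^ 2))) (Set.Ici x) x := by
      simp only [vnDim_eq]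
      refine tendsto_finsetSum _ fun i _ => ?_
      exact (((tendsto_spectralProjection (f.adjoint ∘L f) (x ^ 2) _).comp hsq).norm).pow 2
    refine hmain.congr (fun t ht => if_pos (hx.trans ht)) (if_pos hx)

/-- The spectral density function as a monotone right-continuous function; its Stieltjes measure
is the measure `dF` with `dF(]a,b]) = F(b) - F(a)`. -/
def spectralStieltjes {r s : ℕ} (f : L2Pow G r →L[ℂ] L2Pow G s) : StieltjesFunction ℝ where
  toFun := spectralDensity f
  mono' := spectralDensity_mono f
  right_continuous' := spectralDensity_rightCont f

open scoped Classical in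
/-- The Fuglede-Kadison determinant `exp (∫_{0+}^∞ ln(t) dF(t))` of a bounded operator
`f : L²(G)^r → L²(G)^s`, where `F` is the spectral density function of `f`; it is `0` if the
integral does not converge to a real number. -/
def fkDet {r s : ℕ} (f : L2Pow G r →L[ℂ] L2Pow G s) : ℝ :=
  if IntegrableOn Real.log (Set.Ioi 0) (spectralStieltjes f).measure then
    Real.exp (∫ t in Set.Ioi 0, Real.log t ∂(spectralStieltjes f).measure)
  else 0

/-! ### The Lehmer constants -/

/-- `Λ(G)`: the infimum of the determinants `> 1` of matrices over `ℤG` of arbitrary size. -/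
def lehmer (G : Type u) [Group G] : ℝ :=
  sInf {d : ℝ | 1 < d ∧ ∃ r s : ℕ, 1 ≤ r ∧ 1 ≤ s ∧
    ∃ A : Matrix (Fin r) (Fin s) (MonoidAlgebra ℤ G), fkDet (rightMulMatrix A) = d}

/-- `Λ₁(G)`: the infimum of the determinants `> 1` of `(1,1)`-matrices over `ℤG`. -/
def lehmerOne (G : Type u) [Group G] : ℝ :=
  sInf {d : ℝ | 1 < d ∧
    ∃ A : Matrix (Fin 1) (Fin 1) (MonoidAlgebra ℤ G), fkDet (rightMulMatrix A) = d}

/-- `Λ^w(G)`: the infimum of the determinants `> 1` of square matrices over `ℤG` which induce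
weak isomorphisms. -/
def lehmerWeak (G : Type u) [Group G] : ℝ :=
  sInf {d : ℝ | 1 < d ∧ ∃ r : ℕ, 1 ≤ r ∧ ∃ A : Matrix (Fin r) (Fin r) (MonoidAlgebra ℤ G),
    IsWeakIso (rightMulMatrix A) ∧ fkDet (rightMulMatrix A) = d}

/-- `Λ₁^w(G)`: the infimum of the determinants `> 1` of `(1,1)`-matrices over `ℤG` which induce
weak isomorphisms. -/
def lehmerWeakOne (G : Type u) [Group G] : ℝ :=
  sInf {d : ℝ | 1 < d ∧ ∃ A : Matrix (Fin 1) (Fin 1) (MonoidAlgebra ℤ G),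
    IsWeakIso (rightMulMatrix A) ∧ fkDet (rightMulMatrix A) = d}

end Lehmer

end

noncomputable section

namespace Lehmer

/-! ### Intertwiners and spectral projections -/

section Intertwining

variable {E F : Type*} [NormedAddCommGroup E] [InnerProductSpace ℂ E]
  [NormedAddCommGroup F] [InnerProductSpace ℂ F]

/-! All statements rest on two changes of group. Inducing a matrix from `H` to `G` preserves the
Fuglede-Kadison determinant (`fkDet_inducedMatrix`), and restricting it to a subgroup of index `n`
raises the determinant to the power `n` (`fkDet_restrictedMatrix`). Both are instances of
`Compatible`: extension by zero along an injection of standard bases is an isometry intertwining the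
operators `f* f`. Spectral projections are natural for intertwiners
(`starProjection_spectralSubspace_intertwine`), so the spectral density functions are equal or
differ by the factor `n`. Monotonicity in subgroups and the finite index bounds follow. A matrix
involves only finitely many group elements, which gives the reduction to finitely generated
subgroups.

For a finite group one restricts to the trivial subgroup, where the operator is an integral matrix
`B`. The squared determinant is the product of the nonzero eigenvalues of `B Bᵀ`; up to sign this is
the lowest nonzero coefficient of an integral characteristic polynomial, hence a positive integer
(`fkDet_trivial_sq`). For nonsingular `B` the determinant itself is the integer `|det B|`. So values
above 1 are at least `√2`, respectively 2, before the root of order `|G|` is taken.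

The upper bounds come from explicit elements: `2`, the row `(1 1)`, the sum of all `g ≠ 1`, and `2 +
τ` and `1 + τ` for order two. In order two the regular determinant is `det (M + N) * det (M - N)`,
whose factors have equal parity; this excludes 2 and yields `√3`. -/

lemma aeval_comp_intertwine {S : E →L[ℂ] E} {T : F →L[ℂ] F} (ι : E →L[ℂ] F)
    (h : T ∘L ι = ι ∘L S) (p : Polynomial ℝ) :
    Polynomial.aeval T p ∘L ι = ι ∘L Polynomial.aeval S p := by
  induction p using Polynomial.induction_on' with
  | add p q hp hq => simp only [map_add, ContinuousLinearMap.add_comp,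
      ContinuousLinearMap.comp_add, hp, hq]
  | monomial n a =>
    have hn : (T ^ n) ∘L ι = ι ∘L (S ^ n) := by
      induction n with
      | zero => rfl
      | succ n ih =>
        calc (T ^ (n + 1)) ∘L ι = (T ^ n) ∘L (T ∘L ι) := by rw [pow_succ]; rfl
          _ = ((T ^ n) ∘L ι) ∘L S := by rw [h]; rfl
          _ = ι ∘L (S ^ (n + 1)) := by rw [ih, pow_succ]; rfl
    ext v
    have hv := DFunLike.congr_fun hn v
    simp only [Polynomial.aeval_monomial, ContinuousLinearMap.comp_apply,
      Algebra.algebraMap_eq_smul_one, smul_mul_assoc, one_mul, smul_apply] at hv ⊢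
    -- The polynomial has real coefficients while `ι` is `ℂ`-linear, so the scalars are read in `ℂ`.
    rw [hv, ← Complex.coe_smul, ← Complex.coe_smul, map_smul]

variable [CompleteSpace E] [CompleteSpace F]

lemma norm_cfc_sub_aeval_le {U : E →L[ℂ] E} (hU : IsSelfAdjoint U) {φ : ℝ → ℝ}
    (hφ : Continuous φ) (p : Polynomial ℝ) {δ : ℝ} (hδ : 0 ≤ δ)
    (hp : ∀ t ∈ spectrum ℝ U, |p.eval t - φ t| ≤ δ) :
    ‖cfc φ U - Polynomial.aeval U p‖ ≤ δ := by
  rw [← cfc_polynomial p U hU, ← cfc_sub _ _ U hφ.continuousOn p.continuous.continuousOn]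
  refine norm_cfc_le hδ fun t ht => ?_
  rw [Real.norm_eq_abs, abs_sub_comm]
  exact hp t ht

/-- The functional calculus is natural with respect to bounded intertwiners of selfadjoint
operators. -/
lemma cfc_comp_intertwine {S : E →L[ℂ] E} {T : F →L[ℂ] F} (hS : IsSelfAdjoint S)
    (hT : IsSelfAdjoint T) (ι : E →L[ℂ] F) (h : T ∘L ι = ι ∘L S) {φ : ℝ → ℝ}
    (hφ : Continuous φ) : cfc φ T ∘L ι = ι ∘L cfc φ S := by
  -- One interval contains both spectra, so a single Weierstrass polynomial approximates `φ` for
  -- both operators.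
  obtain ⟨R, hR⟩ : ∃ R : ℝ, spectrum ℝ S ∪ spectrum ℝ T ⊆ Set.Icc (-R) R := by
    have hb := (spectrum.isBounded (𝕜 := ℝ) S).union (spectrum.isBounded (𝕜 := ℝ) T)
    obtain ⟨R, hR⟩ := hb.subset_closedBall 0
    exact ⟨R, by rwa [Real.closedBall_eq_Icc, zero_sub, zero_add] at hR⟩
  rw [← sub_eq_zero, ← norm_le_zero_iff]
  refine le_of_forall_pos_le_add fun ε hε => ?_
  set δ := ε / (2 * (‖ι‖ + 1)) with hδ
  have hd : 0 < δ := by positivity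
  obtain ⟨p, hp⟩ := exists_polynomial_near_of_continuousOn (-R) R φ hφ.continuousOn _ hd
  have h1 := norm_cfc_sub_aeval_le hS hφ p hd.le fun t ht => (hp t (hR (Or.inl ht))).le
  have h2 := norm_cfc_sub_aeval_le hT hφ p hd.le fun t ht => (hp t (hR (Or.inr ht))).le
  have h3 : cfc φ T ∘L ι - ι ∘L cfc φ S =
      (cfc φ T - Polynomial.aeval T p) ∘L ι - ι ∘L (cfc φ S - Polynomial.aeval S p) := by
    rw [ContinuousLinearMap.sub_comp, ContinuousLinearMap.comp_sub, aeval_comp_intertwine ι h]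
    abel
  rw [h3, zero_add]
  calc _ ≤ _ := norm_sub_le _ _
    _ ≤ δ * ‖ι‖ + ‖ι‖ * δ := by
      refine add_le_add ((ContinuousLinearMap.opNorm_comp_le _ _).trans ?_)
        ((ContinuousLinearMap.opNorm_comp_le _ _).trans ?_) <;> gcongr
    _ ≤ δ * (2 * (‖ι‖ + 1)) := by nlinarith
    _ = ε := by rw [hδ]; field_simp

/-- Spectral projections are natural with respect to bounded intertwiners of
selfadjoint operators. -/
lemma starProjection_spectralSubspace_intertwine {S : E →L[ℂ] E} {T : F →L[ℂ] F}
    (hS : IsSelfAdjoint S) (hT : IsSelfAdjoint T) (ι : E →L[ℂ] F) (h : T ∘L ι = ι ∘L S)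
    (μ : ℝ) (v : E) :
    (spectralSubspace T μ).starProjection (ι v) = ι ((spectralSubspace S μ).starProjection v) := by
  have hφ : Continuous fun t : ℝ => max (t - μ) 0 := by fun_prop
  have hc := cfc_comp_intertwine hS hT ι h hφ
  -- `ι` maps the kernel of `φ(S)` into that of `φ(T)`, and `ι*` maps the latter back into the
  -- former. The second fact makes `ι w` orthogonal to the kernel of `φ(T)`; `ι` need not be
  -- isometric.
  refine Submodule.eq_starProjection_of_mem_orthogonal ?_ ?_
  · have hv : cfc (fun t : ℝ => max (t - μ) 0) S ((spectralSubspace S μ).starProjection v) = 0 :=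
      (spectralSubspace S μ).starProjection_apply_mem v
    change cfc (fun t : ℝ => max (t - μ) 0) T (ι _) = 0
    have := DFunLike.congr_fun hc ((spectralSubspace S μ).starProjection v)
    simp only [ContinuousLinearMap.comp_apply] at this
    rw [this, hv, map_zero]
  · rw [← map_sub]
    have hsa := cfc_predicate (R := ℝ) (fun t : ℝ => max (t - μ) 0) S
    have hta := cfc_predicate (R := ℝ) (fun t : ℝ => max (t - μ) 0) T
    have hmem := (spectralSubspace S μ).sub_starProjection_mem_orthogonal v
    set w := v - (spectralSubspace S μ).starProjection v
    intro u hu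
    change cfc (fun t : ℝ => max (t - μ) 0) T u = 0 at hu
    have hadj : ContinuousLinearMap.adjoint ι u ∈ spectralSubspace S μ := by
      change cfc (fun t : ℝ => max (t - μ) 0) S _ = 0
      refine ext_inner_left ℂ fun x => ?_
      rw [inner_zero_right, ← ContinuousLinearMap.adjoint_inner_left, hsa.adjoint_eq,
        ContinuousLinearMap.adjoint_inner_right]
      have := DFunLike.congr_fun hc x
      simp only [ContinuousLinearMap.comp_apply] at this
      rw [← this, ← ContinuousLinearMap.adjoint_inner_right, hta.adjoint_eq, hu, inner_zero_right]
    rw [← ContinuousLinearMap.adjoint_inner_left]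
    exact hmem _ hadj

/-- An eigenvector of a selfadjoint operator lies in the spectral subspaces above its eigenvalue,
and is orthogonal to those below. -/
lemma starProjection_spectralSubspace_eigenvector {T : E →L[ℂ] E} (hT : IsSelfAdjoint T)
    {b : E} {l : ℝ} (hb : T b = (l : ℂ) • b) (μ : ℝ) :
    (spectralSubspace T μ).starProjection b = if l ≤ μ then b else 0 := by
  -- The eigenvector is an intertwiner from multiplication by `l` on `ℂ`, where the functional
  -- calculus is explicit.
  set ι : ℂ →L[ℂ] E := ContinuousLinearMap.toSpanSingleton ℂ b with hι
  have hl : IsSelfAdjoint (algebraMap ℝ (ℂ →L[ℂ] ℂ) l) := IsSelfAdjoint.algebraMap _ (.all l)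
  have h : T ∘L ι = ι ∘L algebraMap ℝ (ℂ →L[ℂ] ℂ) l := by
    ext
    simp [hι, hb, Algebra.algebraMap_eq_smul_one]
  have h1 := starProjection_spectralSubspace_intertwine hl hT ι h μ 1
  have h2 : ι 1 = b := by simp [hι]
  have hz : ∀ z : ℂ, z ∈ spectralSubspace (algebraMap ℝ (ℂ →L[ℂ] ℂ) l) μ ↔
      (max (l - μ) 0 : ℝ) • z = 0 := by
    intro z
    unfold spectralSubspace
    rw [cfc_algebraMap, LinearMap.mem_ker]
    simp [Algebra.algebraMap_eq_smul_one]
  rw [h2] at h1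
  rw [h1]
  split_ifs with hlm
  · rw [Submodule.starProjection_eq_self_iff.2, h2]
    rw [hz, max_eq_right (by linarith), zero_smul]
  · rw [(Submodule.starProjection_apply_eq_zero_iff _).2, map_zero]
    intro z h0
    rw [hz, max_eq_left (by linarith), smul_eq_zero] at h0
    rcases h0 with h0 | rfl
    · linarith
    · simp

end Intertwining

/-! ### Coordinates on `L²(G)^r` -/

section Coordinates

variable {G : Type u} {r : ℕ}

/-- The element `g` in position `i`, where `p = (i, g)`; these vectors form the standard Hilbert
basis of `L²(G)^r`. -/
def delta (p : Fin r × G) : L2Pow G r :=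
  open scoped Classical in PiLp.single 2 p.1 (lp.single 2 p.2 (1 : ℂ))

lemma unitVec_eq_delta [Group G] (i : Fin r) : unitVec G r i = delta (i, 1) := rfl

lemma L2Pow_ext {x y : L2Pow G r} (h : ∀ p : Fin r × G, x p.1 p.2 = y p.1 p.2) : x = y :=
  PiLp.ext fun i => lp.ext (funext fun g => h (i, g))

lemma inner_delta (p : Fin r × G) (x : L2Pow G r) : ⟪delta p, x⟫_ℂ = x p.1 p.2 := by
  classical
  rw [delta, PiLp.inner_apply, Finset.sum_eq_single p.1]
  · rw [PiLp.single_apply, if_pos rfl, lp.inner_single_left]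
    simp
  · intro i _ hi
    simp [hi]
  · simp

lemma delta_apply_self (p : Fin r × G) : (delta p : L2Pow G r) p.1 p.2 = 1 := by
  classical
  rw [delta, PiLp.single_apply, if_pos rfl]
  exact lp.single_apply_self _ _ _

lemma delta_apply_of_ne {p q : Fin r × G} (h : q ≠ p) : (delta p : L2Pow G r) q.1 q.2 = 0 := by
  classical
  rw [delta, PiLp.single_apply]
  split_ifs with h1
  · exact lp.single_apply_ne _ _ _ fun h2 => h (Prod.ext h1 h2)
  · rfl

lemma hasSum_norm_sq (x : L2Pow G r) :
    HasSum (fun p : Fin r × G => ‖x p.1 p.2‖ ^ 2) (‖x‖ ^ 2) := by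
  have h2 : 0 < (2 : ℝ≥0∞).toReal := by norm_num
  have h1 : ∀ i, HasSum (fun g => ‖x i g‖ ^ 2) (‖x i‖ ^ 2) := fun i => by
    simpa using lp.hasSum_norm h2 (x i)
  have hs : Summable fun p : Fin r × G => ‖x p.1 p.2‖ ^ 2 :=
    (summable_prod_of_nonneg fun p => by positivity).2 ⟨fun i => (h1 i).summable, .of_finite⟩
  convert hs.hasSum using 1
  rw [hs.tsum_prod, tsum_fintype, PiLp.norm_sq_eq_of_L2]
  exact Finset.sum_congr rfl fun i _ => (h1 i).tsum_eq.symm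

end Coordinates

/-! ### Matrix coefficients of right multiplication -/

section Kernel

variable {G : Type u} [Group G] {r s : ℕ}

lemma rightMul_apply_eq_sum (a : MonoidAlgebra ℤ G) (x : L2 G) (g : G) :
    rightMul a x g = a.coeff.sum fun h n => (n : ℂ) * x (g * h⁻¹) := by
  rw [rightMul, Finsupp.sum, Finsupp.sum, sum_apply, lp.coeFn_sum,
    Finset.sum_apply]
  rfl

lemma summable_coeff_mul (a : MonoidAlgebra ℤ G) (x : G → ℂ) (g : G) :
    Summable fun h => (a.coeff (h⁻¹ * g) : ℂ) * x h := by
  let e : G ≃ G := (Equiv.inv G).trans (Equiv.mulLeft g)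
  refine e.summable_iff.1 (summable_of_ne_finset_zero (s := a.coeff.support) fun h hh => ?_)
  simp [e, Finsupp.notMem_support_iff.1 hh]

lemma rightMul_apply (a : MonoidAlgebra ℤ G) (x : L2 G) (g : G) :
    rightMul a x g = ∑' h, (a.coeff (h⁻¹ * g) : ℂ) * x h := by
  let e : G ≃ G := (Equiv.inv G).trans (Equiv.mulLeft g)
  rw [rightMul_apply_eq_sum, ← e.tsum_eq, tsum_eq_sum (s := a.coeff.support)]
  · simp [e, Finsupp.sum]
  · intro h hh
    simp [e, Finsupp.notMem_support_iff.1 hh]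

lemma rightMulMatrix_apply (A : Matrix (Fin r) (Fin s) (MonoidAlgebra ℤ G))
    (x : L2Pow G r) (j : Fin s) : rightMulMatrix A x j = ∑ k, rightMul (A k j) (x k) := by
  simp [rightMulMatrix]

/-- The matrix coefficients of `r_A^{(2)}` with respect to the standard Hilbert bases. -/
def kernel (A : Matrix (Fin r) (Fin s) (MonoidAlgebra ℤ G))
    (p : Fin s × G) (q : Fin r × G) : ℤ :=
  (A q.1 p.1).coeff (q.2⁻¹ * p.2)

lemma rightMulMatrix_apply_apply (A : Matrix (Fin r) (Fin s) (MonoidAlgebra ℤ G))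
    (x : L2Pow G r) (p : Fin s × G) :
    rightMulMatrix A x p.1 p.2 = ∑' q, (kernel A p q : ℂ) * x q.1 q.2 := by
  have h1 : ∀ k, Summable fun h => (kernel A p (k, h) : ℂ) * x k h := fun k =>
    summable_coeff_mul (A k p.1) (x k) p.2
  have hs : Summable fun q : Fin r × G => (kernel A p q : ℂ) * x q.1 q.2 :=
    .of_norm ((summable_prod_of_nonneg fun q => norm_nonneg _).2 ⟨fun k => (h1 k).norm, .of_finite⟩)
  rw [hs.tsum_prod, tsum_fintype, rightMulMatrix_apply, lp.coeFn_sum, Finset.sum_apply]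
  exact Finset.sum_congr rfl fun k _ => rightMul_apply _ _ _

end Kernel

/-! ### Pull back along injections of the standard bases -/

section Pullback

variable {G H : Type u} {r s : ℕ}

lemma memℓp_pullback (σ : Fin s × H → Fin r × G) (hσ : σ.Injective) (x : L2Pow G r) (i : Fin s) :
    Memℓp (fun h : H => x (σ (i, h)).1 (σ (i, h)).2) 2 := by
  refine memℓp_gen ?_
  have h := (hasSum_norm_sq x).summable.comp_injective (hσ.comp (Prod.mk_right_injective i))
  simpa [Function.comp_def] using h

/-- Composition with an injection of index sets, as a map `L²(G)^r → L²(H)^s`. -/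
def pullback (σ : Fin s × H → Fin r × G) (hσ : σ.Injective) : L2Pow G r →L[ℂ] L2Pow H s :=
  LinearMap.mkContinuous
    { toFun := fun x => WithLp.toLp 2 fun i =>
        ⟨fun h => x (σ (i, h)).1 (σ (i, h)).2, memℓp_pullback σ hσ x i⟩
      map_add' := fun x y => rfl
      map_smul' := fun c x => rfl } 1 fun x => by
    rw [one_mul]
    refine le_of_sq_le_sq ?_ (norm_nonneg _)
    exact hasSum_le_inj σ hσ (fun _ _ => by positivity) (fun _ => le_rfl)
      (hasSum_norm_sq (WithLp.toLp 2 fun i =>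
        (⟨fun h => x (σ (i, h)).1 (σ (i, h)).2, memℓp_pullback σ hσ x i⟩ : L2 H)))
      (hasSum_norm_sq x)

variable {σ : Fin s × H → Fin r × G} (hσ : σ.Injective)

lemma pullback_apply (x : L2Pow G r) (p : Fin s × H) :
    pullback σ hσ x p.1 p.2 = x (σ p).1 (σ p).2 := rfl

lemma pullback_delta (p : Fin s × H) : pullback σ hσ (delta (σ p)) = delta p := by
  refine L2Pow_ext fun q => ?_
  rw [pullback_apply]
  by_cases h : q = p
  · rw [h, delta_apply_self, delta_apply_self]
  · rw [delta_apply_of_ne h, delta_apply_of_ne (hσ.ne h)]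

lemma pullback_delta_of_notMem_range {q : Fin r × G} (hq : q ∉ Set.range σ) :
    pullback σ hσ (delta q) = 0 := by
  refine L2Pow_ext fun p => ?_
  rw [pullback_apply, delta_apply_of_ne fun h => hq ⟨p, h⟩]
  rfl

/-- Extension by zero along an injection of index sets, as a map `L²(H)^s → L²(G)^r`. -/
def pushforward (σ : Fin s × H → Fin r × G) (hσ : σ.Injective) : L2Pow H s →L[ℂ] L2Pow G r :=
  (pullback σ hσ).adjoint

lemma pushforward_apply (y : L2Pow H s) (p : Fin s × H) :
    pushforward σ hσ y (σ p).1 (σ p).2 = y p.1 p.2 := by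
  rw [← inner_delta, pushforward, ContinuousLinearMap.adjoint_inner_right, pullback_delta,
    inner_delta]

lemma pushforward_apply_of_notMem_range (y : L2Pow H s) {q : Fin r × G} (hq : q ∉ Set.range σ) :
    pushforward σ hσ y q.1 q.2 = 0 := by
  rw [← inner_delta, pushforward, ContinuousLinearMap.adjoint_inner_right,
    pullback_delta_of_notMem_range hσ hq, inner_zero_left]

lemma pullback_pushforward (y : L2Pow H s) : pullback σ hσ (pushforward σ hσ y) = y :=
  L2Pow_ext fun p => pushforward_apply hσ y p

lemma pushforward_injective : Function.Injective (pushforward σ hσ) :=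
  Function.LeftInverse.injective (pullback_pushforward hσ)

lemma norm_pushforward (y : L2Pow H s) : ‖pushforward σ hσ y‖ = ‖y‖ := by
  have h : ⟪pushforward σ hσ y, pushforward σ hσ y⟫_ℂ = ⟪y, y⟫_ℂ := by
    conv_lhs => rw [pushforward, ContinuousLinearMap.adjoint_inner_left, ← pushforward,
      pullback_pushforward]
  rw [norm_eq_sqrt_re_inner (𝕜 := ℂ), h, ← norm_eq_sqrt_re_inner]

lemma pushforward_delta (p : Fin s × H) : pushforward σ hσ (delta p) = delta (σ p) := by
  refine L2Pow_ext fun q => ?_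
  by_cases hq : q ∈ Set.range σ
  · obtain ⟨q, rfl⟩ := hq
    rw [pushforward_apply, ← pullback_apply hσ (delta (σ p)), pullback_delta]
  · rw [pushforward_apply_of_notMem_range hσ _ hq, delta_apply_of_ne fun h => hq ⟨p, h.symm⟩]

end Pullback

/-- The orthogonal complement of the range is the kernel of the adjoint. In this form the property
consists of two kernel conditions, which transfer between compatible operators. -/
lemma isWeakIso_iff {G : Type u} {r s : ℕ} (f : L2Pow G r →L[ℂ] L2Pow G s) :
    IsWeakIso f ↔ Function.Injective f ∧ Function.Injective f.adjoint := by
  refine and_congr_right fun _ => ?_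
  have h1 : DenseRange f ↔ f.range.topologicalClosure = ⊤ := by
    rw [← Submodule.dense_iff_topologicalClosure_eq_top]
    rfl
  rw [h1, Submodule.topologicalClosure_eq_top_iff, ContinuousLinearMap.orthogonal_range,
    LinearMap.ker_eq_bot]
  rfl

/-! ### Operators which correspond under an injection of the standard bases -/

section Compatible

variable {G H : Type u} [Group G] [Group H] {r s r' s' : ℕ}

/-- The matrix of `r_{A'}^{(2)}` is the submatrix of that of `r_A^{(2)}` on the images of `σ` and
`τ`, and these images span a reducing subspace. -/
structure Compatible (A : Matrix (Fin r) (Fin s) (MonoidAlgebra ℤ G))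
    (A' : Matrix (Fin r') (Fin s') (MonoidAlgebra ℤ H))
    (σ : Fin r' × H → Fin r × G) (τ : Fin s' × H → Fin s × G) : Prop where
  inj_left : σ.Injective
  inj_right : τ.Injective
  kernel_eq : ∀ p q, kernel A (τ p) (σ q) = kernel A' p q
  mem_left : ∀ p q, kernel A (τ p) q ≠ 0 → q ∈ Set.range σ
  mem_right : ∀ p q, kernel A p (σ q) ≠ 0 → p ∈ Set.range τ

variable {A : Matrix (Fin r) (Fin s) (MonoidAlgebra ℤ G)}
  {A' : Matrix (Fin r') (Fin s') (MonoidAlgebra ℤ H)}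
  {σ : Fin r' × H → Fin r × G} {τ : Fin s' × H → Fin s × G}

namespace Compatible

/-- By `mem_left`, the rows over the range of `τ` are supported on the range of `σ`, so the sum
collapses to that range. -/
lemma pullback_comp (h : Compatible A A' σ τ) :
    pullback τ h.inj_right ∘L rightMulMatrix A = rightMulMatrix A' ∘L pullback σ h.inj_left := by
  ext x : 1
  refine L2Pow_ext fun p => ?_
  rw [ContinuousLinearMap.comp_apply, ContinuousLinearMap.comp_apply, pullback_apply,
    rightMulMatrix_apply_apply, rightMulMatrix_apply_apply, ← h.inj_left.tsum_eq]
  · refine tsum_congr fun q => ?_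
    rw [h.kernel_eq, pullback_apply]
  · intro q hq
    refine h.mem_left p q fun h0 => hq ?_
    simp [h0]

lemma comp_pushforward (h : Compatible A A' σ τ) :
    rightMulMatrix A ∘L pushforward σ h.inj_left =
      pushforward τ h.inj_right ∘L rightMulMatrix A' := by
  ext y : 1
  refine L2Pow_ext fun p => ?_
  simp only [ContinuousLinearMap.comp_apply]
  by_cases hp : p ∈ Set.range τ
  · obtain ⟨p, rfl⟩ := hp
    rw [pushforward_apply, ← pullback_apply h.inj_right]
    have := DFunLike.congr_fun h.pullback_comp (pushforward σ h.inj_left y)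
    simp only [ContinuousLinearMap.comp_apply] at this
    rw [this, pullback_pushforward]
  · rw [pushforward_apply_of_notMem_range _ _ hp, rightMulMatrix_apply_apply]
    refine (tsum_congr fun q => ?_).trans tsum_zero
    by_cases hq : q ∈ Set.range σ
    · obtain ⟨q, rfl⟩ := hq
      have h0 : kernel A p (σ q) = 0 := by
        by_contra h0
        exact hp (h.mem_right p q h0)
      simp [h0]
    · rw [pushforward_apply_of_notMem_range _ _ hq, mul_zero]

/-- Since `pushforward` is the adjoint of `pullback`, this is the adjoint of `pullback_comp`; no
matrix formula for the adjoint is needed. -/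
lemma adjoint_comp_pushforward (h : Compatible A A' σ τ) :
    (rightMulMatrix A).adjoint ∘L pushforward τ h.inj_right =
      pushforward σ h.inj_left ∘L (rightMulMatrix A').adjoint := by
  simpa only [ContinuousLinearMap.adjoint_comp, pushforward] using
    congrArg ContinuousLinearMap.adjoint h.pullback_comp

lemma pullback_comp_adjoint (h : Compatible A A' σ τ) :
    pullback σ h.inj_left ∘L (rightMulMatrix A).adjoint =
      (rightMulMatrix A').adjoint ∘L pullback τ h.inj_right := by
  simpa only [ContinuousLinearMap.adjoint_comp, pushforward,
    ContinuousLinearMap.adjoint_adjoint] using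
    congrArg ContinuousLinearMap.adjoint h.comp_pushforward

/-- Extension by zero is isometric and intertwines the two operators `f* f`, hence their spectral
projections. -/
lemma norm_starProjection_delta (h : Compatible A A' σ τ) (μ : ℝ) (p : Fin r' × H) :
    ‖(spectralSubspace ((rightMulMatrix A).adjoint ∘L rightMulMatrix A) μ).starProjection
        (delta (σ p))‖ =
      ‖(spectralSubspace ((rightMulMatrix A').adjoint ∘L rightMulMatrix A') μ).starProjection
        (delta p)‖ := by
  rw [← pushforward_delta h.inj_left, starProjection_spectralSubspace_intertwine
    (ContinuousLinearMap.isPositive_adjoint_comp_self (rightMulMatrix A')).isSelfAdjoint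
    (ContinuousLinearMap.isPositive_adjoint_comp_self (rightMulMatrix A)).isSelfAdjoint, norm_pushforward]
  rw [ContinuousLinearMap.comp_assoc, h.comp_pushforward, ← ContinuousLinearMap.comp_assoc,
    h.adjoint_comp_pushforward, ContinuousLinearMap.comp_assoc]

end Compatible

/-- Left translation on the standard basis. -/
def leftShift (r : ℕ) (g : G) (p : Fin r × G) : Fin r × G := (p.1, g * p.2)

lemma leftShift_leftShift_inv (g : G) (p : Fin r × G) :
    leftShift r g (leftShift r g⁻¹ p) = p := by simp [leftShift]

/-- This encodes `G`-equivariance: matrix coefficients depend on group elements only through `q.2⁻¹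
* p.2`. -/
lemma compatible_leftShift (A : Matrix (Fin r) (Fin s) (MonoidAlgebra ℤ G)) (g : G) :
    Compatible A A (leftShift r g) (leftShift s g) where
  inj_left p q h := by simpa [leftShift, Prod.ext_iff] using h
  inj_right p q h := by simpa [leftShift, Prod.ext_iff] using h
  kernel_eq p q := by simp [kernel, leftShift, mul_assoc]
  mem_left _ q _ := ⟨_, leftShift_leftShift_inv g q⟩
  mem_right p _ _ := ⟨_, leftShift_leftShift_inv g p⟩

namespace Compatible

/-- By equivariance the group coordinate of `σ (i, 1)` can be translated to `1`, so only its
position in `Fin r` matters. -/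
lemma spectralDensity_eq (h : Compatible A A' σ τ) {t : ℝ} (ht : 0 ≤ t) :
    spectralDensity (rightMulMatrix A') t = ∑ i,
      ‖(spectralSubspace ((rightMulMatrix A).adjoint ∘L rightMulMatrix A) (t ^ 2)).starProjection
        (delta ((σ (i, 1)).1, 1))‖ ^ 2 := by
  rw [spectralDensity, if_pos ht, vnDim_eq]
  refine Finset.sum_congr rfl fun i _ => ?_
  rw [unitVec_eq_delta, ← h.norm_starProjection_delta,
    ← (compatible_leftShift A (σ (i, 1)).2).norm_starProjection_delta _ (_, 1)]
  simp [leftShift]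

lemma injective_of_injective (h : Compatible A A' σ τ)
    (hA : Function.Injective (rightMulMatrix A)) : Function.Injective (rightMulMatrix A') := by
  have := hA.comp (pushforward_injective h.inj_left)
  rw [← ContinuousLinearMap.coe_comp, h.comp_pushforward, ContinuousLinearMap.coe_comp] at this
  exact this.of_comp

lemma adjoint_injective_of_injective (h : Compatible A A' σ τ)
    (hA : Function.Injective (rightMulMatrix A).adjoint) :
    Function.Injective (rightMulMatrix A').adjoint := by
  have := hA.comp (pushforward_injective h.inj_right)
  rw [← ContinuousLinearMap.coe_comp, h.adjoint_comp_pushforward, ContinuousLinearMap.coe_comp] at this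
  exact this.of_comp

/-- For the converse, any coordinate of a kernel vector can be left translated into the range of
`σ`, provided `σ` meets every position. There the pulled back vector lies in the kernel for `A'` and
vanishes. -/
lemma injective_iff (h : Compatible A A' σ τ) (hσ : ∀ i, ∃ p, (σ p).1 = i) :
    Function.Injective (rightMulMatrix A) ↔ Function.Injective (rightMulMatrix A') := by
  refine ⟨h.injective_of_injective, fun hA' => (injective_iff_map_eq_zero _).2 fun x hx => ?_⟩
  refine L2Pow_ext fun q => ?_
  obtain ⟨p, hp⟩ := hσ q.1
  have hg := compatible_leftShift A (q.2 * (σ p).2⁻¹)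
  have h1 := DFunLike.congr_fun hg.pullback_comp x
  have h2 := DFunLike.congr_fun h.pullback_comp (pullback _ hg.inj_left x)
  simp only [ContinuousLinearMap.comp_apply] at h1 h2
  rw [← h1, hx, map_zero, map_zero] at h2
  have h3 := (injective_iff_map_eq_zero _).1 hA' _ h2.symm
  have h4 := pullback_apply h.inj_left (pullback _ hg.inj_left x) p
  rw [h3, pullback_apply] at h4
  simpa [leftShift, hp] using h4.symm

lemma adjoint_injective_iff (h : Compatible A A' σ τ) (hτ : ∀ i, ∃ p, (τ p).1 = i) :
    Function.Injective (rightMulMatrix A).adjoint ↔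
      Function.Injective (rightMulMatrix A').adjoint := by
  refine ⟨h.adjoint_injective_of_injective,
    fun hA' => (injective_iff_map_eq_zero _).2 fun x hx => ?_⟩
  refine L2Pow_ext fun q => ?_
  obtain ⟨p, hp⟩ := hτ q.1
  have hg := compatible_leftShift A (q.2 * (τ p).2⁻¹)
  have h1 := DFunLike.congr_fun hg.pullback_comp_adjoint x
  have h2 := DFunLike.congr_fun h.pullback_comp_adjoint (pullback _ hg.inj_right x)
  simp only [ContinuousLinearMap.comp_apply] at h1 h2
  rw [← h1, hx, map_zero, map_zero] at h2
  have h3 := (injective_iff_map_eq_zero _).1 hA' _ h2.symm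
  have h4 := pullback_apply h.inj_right (pullback _ hg.inj_right x) p
  rw [h3, pullback_apply] at h4
  simpa [leftShift, hp] using h4.symm

end Compatible

lemma Compatible.isWeakIso_iff (h : Compatible A A' σ τ) (hσ : ∀ i, ∃ p, (σ p).1 = i)
    (hτ : ∀ i, ∃ p, (τ p).1 = i) :
    IsWeakIso (rightMulMatrix A) ↔ IsWeakIso (rightMulMatrix A') := by
  rw [Lehmer.isWeakIso_iff, Lehmer.isWeakIso_iff, h.injective_iff hσ, h.adjoint_injective_iff hτ]

end Compatible

/-! ### Determinants of operators with proportional spectral density functions -/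

lemma fkDet_eq_pow {G H : Type u} [Group G] [Group H] {r s r' s' : ℕ}
    (f : L2Pow G r →L[ℂ] L2Pow G s) (f' : L2Pow H r' →L[ℂ] L2Pow H s') {n : ℕ} (hn : n ≠ 0)
    (h : ∀ t, 0 ≤ t → spectralDensity f' t = n * spectralDensity f t) :
    fkDet f' = fkDet f ^ n := by
  have hm : (spectralStieltjes f').measure = (n : ℝ≥0∞) • (spectralStieltjes f).measure := by
    have : spectralStieltjes f' = (n : NNReal) • spectralStieltjes f := by
      ext t
      change spectralDensity f' t = (n : NNReal) • spectralDensity f t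
      rw [NNReal.smul_def, NNReal.coe_natCast, smul_eq_mul]
      by_cases ht : 0 ≤ t
      · exact h t ht
      · simp [spectralDensity, ht]
    rw [this, StieltjesFunction.measure_smul]
    ext S
    simp [ENNReal.smul_def]
  have hn' : (n : ℝ≥0∞) ≠ 0 := by exact_mod_cast hn
  have hi : IntegrableOn Real.log (Set.Ioi 0) (spectralStieltjes f').measure ↔
      IntegrableOn Real.log (Set.Ioi 0) (spectralStieltjes f).measure := by
    rw [hm, IntegrableOn, Measure.restrict_smul,
      integrable_smul_measure hn' (ENNReal.natCast_ne_top n), IntegrableOn]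
  unfold fkDet
  by_cases hf : IntegrableOn Real.log (Set.Ioi 0) (spectralStieltjes f).measure
  · rw [if_pos hf, if_pos (hi.2 hf), hm, Measure.restrict_smul, integral_smul_measure, ENNReal.toReal_natCast, smul_eq_mul,
      Real.exp_nat_mul]
  -- If the integral diverges, both determinants take the value `0`, and `0 ^ n = 0` because `n ≠
  -- 0`.
  · rw [if_neg hf, if_neg (hf ∘ hi.1), zero_pow hn]

/-! ### Induction along injective homomorphisms -/

section Induction

variable {G H : Type u} [Group G] [Group H] {r s : ℕ}

/-- The matrix over `ℤG` induced by a matrix over `ℤH` and a homomorphism `H → G`. -/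
def inducedMatrix (φ : H →* G) (A : Matrix (Fin r) (Fin s) (MonoidAlgebra ℤ H)) :
    Matrix (Fin r) (Fin s) (MonoidAlgebra ℤ G) :=
  A.map (MonoidAlgebra.mapDomain φ)

/-- All supports lie in the range of `φ`, so right multiplication preserves its left cosets and
`L²(H)` is reducing. -/
lemma compatible_inducedMatrix {φ : H →* G} (hφ : Function.Injective φ)
    (A : Matrix (Fin r) (Fin s) (MonoidAlgebra ℤ H)) :
    Compatible (inducedMatrix φ A) A (Prod.map id φ) (Prod.map id φ) where
  inj_left := Function.injective_id.prodMap hφ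
  inj_right := Function.injective_id.prodMap hφ
  kernel_eq p q := by
    simp only [kernel, inducedMatrix, Matrix.map_apply, MonoidAlgebra.mapDomain, Prod.map_fst,
      Prod.map_snd, id, ← map_inv, ← map_mul]
    exact Finsupp.mapDomain_apply hφ _ _
  mem_left p q h := by
    obtain ⟨x, hx⟩ : q.2⁻¹ * φ p.2 ∈ Set.range φ := by
      by_contra h0
      exact h (Finsupp.mapDomain_of_notMem_range _ _ h0)
    refine ⟨(q.1, p.2 * x⁻¹), ?_⟩
    simp [hx]
  mem_right p q h := by
    obtain ⟨x, hx⟩ : (φ q.2)⁻¹ * p.2 ∈ Set.range φ := by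
      by_contra h0
      exact h (Finsupp.mapDomain_of_notMem_range _ _ h0)
    refine ⟨(p.1, q.2 * x), ?_⟩
    simp [hx]

lemma fkDet_inducedMatrix {φ : H →* G} (hφ : Function.Injective φ)
    (A : Matrix (Fin r) (Fin s) (MonoidAlgebra ℤ H)) :
    fkDet (rightMulMatrix (inducedMatrix φ A)) = fkDet (rightMulMatrix A) := by
  rw [← pow_one (fkDet (rightMulMatrix A))]
  refine fkDet_eq_pow _ _ one_ne_zero fun t ht => ?_
  rw [(compatible_inducedMatrix hφ A).spectralDensity_eq ht, Nat.cast_one, one_mul,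
    spectralDensity, if_pos ht, vnDim_eq]
  rfl

lemma isWeakIso_inducedMatrix_iff {φ : H →* G} (hφ : Function.Injective φ)
    (A : Matrix (Fin r) (Fin s) (MonoidAlgebra ℤ H)) :
    IsWeakIso (rightMulMatrix (inducedMatrix φ A)) ↔ IsWeakIso (rightMulMatrix A) :=
  (compatible_inducedMatrix hφ A).isWeakIso_iff (fun i => ⟨(i, 1), rfl⟩) fun i => ⟨(i, 1), rfl⟩

lemma exists_fg_inducedMatrix (A : Matrix (Fin r) (Fin s) (MonoidAlgebra ℤ G)) :
    ∃ H : Subgroup G, H.FG ∧ ∃ B : Matrix (Fin r) (Fin s) (MonoidAlgebra ℤ H),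
      inducedMatrix H.subtype B = A := by
  classical
  let S : Finset G := Finset.univ.biUnion fun p : Fin r × Fin s => (A p.1 p.2).coeff.support
  refine ⟨Subgroup.closure S, ⟨S, rfl⟩, fun i j => MonoidAlgebra.comapDomain _
    (Subgroup.subtype_injective _) (A i j), ?_⟩
  ext1 i j
  refine MonoidAlgebra.mapDomain_comapDomain (fun g hg => ?_) _
  refine ⟨⟨g, Subgroup.subset_closure ?_⟩, rfl⟩
  exact Finset.mem_coe.2 (Finset.mem_biUnion.2 ⟨(i, j), Finset.mem_univ _, hg⟩)

end Induction

/-! ### Restriction to subgroups of finite index -/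

section Restriction

variable {G : Type u} [Group G] {H : Subgroup G} {r s n : ℕ}

/-- The matrix over `ℤH` which describes `r_A^{(2)}` as a map of `L²(H)`-modules, for a system of
representatives `t` of the right cosets of `H`. -/
def restrictedMatrix (H : Subgroup G) (t : Fin n → G)
    (A : Matrix (Fin r) (Fin s) (MonoidAlgebra ℤ G)) :
    Matrix (Fin (r * n)) (Fin (s * n)) (MonoidAlgebra ℤ H) :=
  fun p q => MonoidAlgebra.comapDomain
    (fun h : H => (t (finProdFinEquiv.symm p).2)⁻¹ * h * t (finProdFinEquiv.symm q).2)
    (fun a b h => by simpa using h)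
    (A (finProdFinEquiv.symm p).1 (finProdFinEquiv.symm q).1)

/-- The bijection of the standard bases belonging to a system of representatives. -/
def cosetShift (H : Subgroup G) (t : Fin n → G) (r : ℕ) (p : Fin (r * n) × H) : Fin r × G :=
  ((finProdFinEquiv.symm p.1).1, p.2 * t (finProdFinEquiv.symm p.1).2)

lemma bijective_cosetShift {t : Fin n → G}
    (ht : Function.Bijective fun p : H × Fin n => (p.1 : G) * t p.2) (r : ℕ) :
    Function.Bijective (cosetShift H t r) := by
  constructor
  · intro p q h
    obtain ⟨h1, h2⟩ := Prod.ext_iff.1 h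
    have h3 := ht.1 (a₁ := (p.2, (finProdFinEquiv.symm p.1).2))
      (a₂ := (q.2, (finProdFinEquiv.symm q.1).2)) h2
    obtain ⟨h4, h5⟩ := Prod.ext_iff.1 h3
    exact Prod.ext (finProdFinEquiv.symm.injective (Prod.ext h1 h5)) h4
  · rintro ⟨i, g⟩
    obtain ⟨p, hp⟩ := ht.2 g
    exact ⟨(finProdFinEquiv (i, p.2), p.1), by simpa [cosetShift] using hp⟩

lemma compatible_restrictedMatrix {t : Fin n → G}
    (ht : Function.Bijective fun p : H × Fin n => (p.1 : G) * t p.2)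
    (A : Matrix (Fin r) (Fin s) (MonoidAlgebra ℤ G)) :
    Compatible A (restrictedMatrix H t A) (cosetShift H t r) (cosetShift H t s) where
  inj_left := (bijective_cosetShift ht r).1
  inj_right := (bijective_cosetShift ht s).1
  kernel_eq p q := by
    simp [kernel, restrictedMatrix, cosetShift, mul_assoc]
  mem_left _ q _ := (bijective_cosetShift ht r).2 q
  mem_right p _ _ := (bijective_cosetShift ht s).2 p

/-- Each position `i` occurs once for every coset representative, so the spectral density is
multiplied by `n`. -/
lemma fkDet_restrictedMatrix (hn : n ≠ 0) {t : Fin n → G}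
    (ht : Function.Bijective fun p : H × Fin n => (p.1 : G) * t p.2)
    (A : Matrix (Fin r) (Fin s) (MonoidAlgebra ℤ G)) :
    fkDet (rightMulMatrix (restrictedMatrix H t A)) = fkDet (rightMulMatrix A) ^ n := by
  refine fkDet_eq_pow _ _ hn fun x hx => ?_
  rw [(compatible_restrictedMatrix ht A).spectralDensity_eq hx, ← finProdFinEquiv.sum_comp,
    Fintype.sum_prod_type, spectralDensity, if_pos hx, vnDim_eq, Finset.mul_sum]
  refine Finset.sum_congr rfl fun i _ => ?_
  simp [cosetShift, unitVec_eq_delta]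

lemma isWeakIso_restrictedMatrix_iff {t : Fin n → G}
    (ht : Function.Bijective fun p : H × Fin n => (p.1 : G) * t p.2)
    (A : Matrix (Fin r) (Fin s) (MonoidAlgebra ℤ G)) :
    IsWeakIso (rightMulMatrix A) ↔ IsWeakIso (rightMulMatrix (restrictedMatrix H t A)) := by
  refine (compatible_restrictedMatrix ht A).isWeakIso_iff (fun i => ?_) fun i => ?_
  · exact ((bijective_cosetShift ht r).2 (i, 1)).imp fun p hp => by rw [hp]
  · exact ((bijective_cosetShift ht s).2 (i, 1)).imp fun p hp => by rw [hp]

lemma exists_transversal (H : Subgroup G) [H.FiniteIndex] :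
    ∃ t : Fin H.index → G, Function.Bijective fun p : H × Fin H.index => (p.1 : G) * t p.2 := by
  obtain ⟨T, hT, -⟩ := H.exists_isComplement_right 1
  have : Finite T := hT.finite_right
  let e : Fin H.index ≃ T := (Finite.equivFinOfCardEq hT.card_right).symm
  exact ⟨fun i => e i, hT.comp ((Equiv.refl H).prodCongr e).bijective⟩

end Restriction

/-! ### Operators with finite spectrum -/

/-- The density is a step function, so `dF` is a sum of Dirac measures at the points `√(l i)`. Mass
at 0 lies outside the domain of integration, whence the factor 1. -/
lemma fkDet_eq_prod {G : Type u} [Group G] {r s : ℕ} (f : L2Pow G r →L[ℂ] L2Pow G s)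
    {ι : Type*} [Fintype ι] (l : ι → ℝ) (hl : ∀ i, 0 ≤ l i)
    (h : ∀ t, 0 ≤ t → spectralDensity f t = ∑ i, if l i ≤ t ^ 2 then 1 else 0) :
    fkDet f = ∏ i, if l i = 0 then 1 else √(l i) := by
  have hF : ∀ t, spectralDensity f t = ∑ i, if √(l i) ≤ t then 1 else 0 := by
    intro t
    by_cases ht : 0 ≤ t
    · rw [h t ht]
      simp only [Real.sqrt_le_left ht]
    · rw [spectralDensity, if_neg ht, Finset.sum_eq_zero]
      intro i _
      rw [if_neg]
      have := Real.sqrt_nonneg (l i)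
      linarith
  have hm : (spectralStieltjes f).measure = ∑ i, Measure.dirac √(l i) := by
    refine Measure.ext_of_Ioc _ _ fun a b hab => ?_
    rw [StieltjesFunction.measure_Ioc]
    change ENNReal.ofReal (spectralDensity f b - spectralDensity f a) = _
    rw [hF, hF, ← Finset.sum_sub_distrib, ENNReal.ofReal_sum_of_nonneg, Measure.finsetSum_apply]
    · refine Finset.sum_congr rfl fun i _ => ?_
      rw [Measure.dirac_apply' _ measurableSet_Ioc, Set.indicator_apply]
      by_cases h1 : √(l i) ≤ a
      · simp [h1, h1.trans hab.le]
      · by_cases h2 : √(l i) ≤ b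
        · simp [h1, h2, not_le.1 h1]
        · simp [h1, h2]
    · intro i _
      by_cases h1 : √(l i) ≤ a
      · simp [h1, h1.trans hab.le]
      · simp only [h1, if_false]
        split_ifs <;> norm_num
  have hint : ∀ i ∈ Finset.univ, Integrable ((Set.Ioi 0).indicator Real.log)
      (Measure.dirac √(l i)) := fun i _ => integrable_dirac (by simp)
  have hi : IntegrableOn Real.log (Set.Ioi 0) (spectralStieltjes f).measure := by
    rw [← integrable_indicator_iff measurableSet_Ioi, hm]
    exact integrable_finsetSum_measure.2 hint
  rw [fkDet, if_pos hi, ← integral_indicator measurableSet_Ioi, hm,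
    integral_finsetSum_measure hint, Real.exp_sum]
  refine Finset.prod_congr rfl fun i _ => ?_
  rw [integral_dirac]
  split_ifs with h0
  · simp [h0]
  · have : 0 < √(l i) := Real.sqrt_pos.2 (lt_of_le_of_ne (hl i) (Ne.symm h0))
    rw [Set.indicator_of_mem (Set.mem_Ioi.2 this), Real.exp_log this]

/-- The trace of a projection does not depend on the orthonormal basis; this allows the von Neumann
dimension to be computed in an eigenbasis. -/
lemma sum_norm_sq_starProjection_eq {E ι κ : Type*} [NormedAddCommGroup E]
    [InnerProductSpace ℂ E] [Fintype ι] [Fintype κ] (b : OrthonormalBasis ι ℂ E)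
    (c : OrthonormalBasis κ ℂ E) (V : Submodule ℂ E) [V.HasOrthogonalProjection] :
    ∑ i, ‖V.starProjection (b i)‖ ^ 2 = ∑ j, ‖V.starProjection (c j)‖ ^ 2 := by
  simp_rw [← c.sum_sq_norm_inner_right (V.starProjection (b _)),
    ← b.sum_sq_norm_inner_left (V.starProjection (c _))]
  rw [Finset.sum_comm]
  simp_rw [V.inner_starProjection_left_eq_right]

/-! ### The trivial group -/

section Trivial

variable {E : Type u} [Group E] [Subsingleton E] {r s : ℕ}

/-- The standard orthonormal basis of `L²({1})^r = ℂ^r`. -/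
def unitBasis (E : Type u) [Group E] [Subsingleton E] (r : ℕ) :
    OrthonormalBasis (Fin r) ℂ (L2Pow E r) :=
  OrthonormalBasis.mkOfOrthogonalEqBot (v := unitVec E r)
    (by
      classical
      rw [orthonormal_iff_ite]
      intro i j
      rw [unitVec_eq_delta, inner_delta, unitVec_eq_delta]
      split_ifs with h
      · rw [h]; exact delta_apply_self (j, (1 : E))
      · exact delta_apply_of_ne fun h' => h (Prod.ext_iff.1 h').1)
    (by
      refine (Submodule.eq_bot_iff _).2 fun x hx => L2Pow_ext fun p => ?_
      rw [← inner_delta, show p = (p.1, 1) from Prod.ext rfl (Subsingleton.elim _ _)]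
      exact hx _ (Submodule.subset_span ⟨p.1, rfl⟩))

lemma unitBasis_apply (i : Fin r) : unitBasis E r i = unitVec E r i := by
  simp [unitBasis]

lemma unitBasis_repr_apply (x : L2Pow E r) (i : Fin r) : (unitBasis E r).repr x i = x i 1 := by
  rw [OrthonormalBasis.repr_apply_apply, unitBasis_apply, unitVec_eq_delta, inner_delta]

/-- The integral matrix of a matrix over the integral group ring of the trivial group. -/
def intMatrix (A : Matrix (Fin r) (Fin s) (MonoidAlgebra ℤ E)) : Matrix (Fin r) (Fin s) ℤ :=
  A.map fun a => a.coeff 1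

lemma rightMulMatrix_apply_one (A : Matrix (Fin r) (Fin s) (MonoidAlgebra ℤ E))
    (x : L2Pow E r) (j : Fin s) :
    rightMulMatrix A x j 1 = ∑ i, (intMatrix A i j : ℂ) * x i 1 := by
  have := rightMulMatrix_apply_apply A x (j, 1)
  let e : Fin r ≃ Fin r × E :=
    { toFun := fun i => (i, 1), invFun := Prod.fst, left_inv := fun _ => rfl,
      right_inv := fun p => Prod.ext rfl (Subsingleton.elim _ _) }
  rw [← e.tsum_eq, tsum_fintype] at this
  simpa [e, kernel, intMatrix] using this

lemma adjoint_rightMulMatrix_apply_one (A : Matrix (Fin r) (Fin s) (MonoidAlgebra ℤ E))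
    (y : L2Pow E s) (i : Fin r) :
    (rightMulMatrix A).adjoint y i 1 = ∑ j, (intMatrix A i j : ℂ) * y j 1 := by
  classical
  rw [← inner_delta (i, (1 : E)) _, ContinuousLinearMap.adjoint_inner_right,
    ← (unitBasis E s).sum_inner_mul_inner]
  refine Finset.sum_congr rfl fun j _ => ?_
  rw [unitBasis_apply, unitVec_eq_delta, inner_delta, ← inner_conj_symm, inner_delta,
    rightMulMatrix_apply_one, Finset.sum_eq_single i]
  · rw [delta_apply_self (i, (1 : E))]
    simp
  · intro k _ hk
    rw [delta_apply_of_ne (q := (k, (1 : E))) fun h => hk (Prod.ext_iff.1 h).1, mul_zero]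
  · simp

/-- Vectors are rows here, so `f* f` has matrix `B Bᵀ` rather than `Bᵀ B`. Each eigenvector lies
either in the spectral subspace or in its orthogonal complement. -/
lemma spectralDensity_trivial (A : Matrix (Fin r) (Fin s) (MonoidAlgebra ℤ E))
    (hM : ((intMatrix A * (intMatrix A).transpose).map (Int.castRingHom ℂ)).IsHermitian)
    {t : ℝ} (ht : 0 ≤ t) :
    spectralDensity (rightMulMatrix A) t = ∑ j, if hM.eigenvalues j ≤ t ^ 2 then 1 else 0 := by
  rw [spectralDensity, if_pos ht, vnDim_eq]
  simp_rw [← unitBasis_apply]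
  let c := hM.eigenvectorBasis.map (unitBasis E r).repr.symm
  rw [sum_norm_sq_starProjection_eq _ c]
  refine Finset.sum_congr rfl fun j _ => ?_
  have hc : ((rightMulMatrix A).adjoint ∘L rightMulMatrix A) (c j) =
      (hM.eigenvalues j : ℂ) • c j := by
    refine L2Pow_ext fun p => ?_
    have hcj : ∀ i, c j i 1 = hM.eigenvectorBasis j i := fun i => by
      rw [← unitBasis_repr_apply]
      simp [c]
    rw [show p = (p.1, 1) from Prod.ext rfl (Subsingleton.elim _ _)]
    have h1 := congrFun (hM.mulVec_eigenvectorBasis j) p.1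
    have h2 : ((hM.eigenvalues j : ℂ) • c j) p.1 1 = hM.eigenvalues j * c j p.1 1 := rfl
    change (rightMulMatrix A).adjoint (rightMulMatrix A (c j)) p.1 1 =
      ((hM.eigenvalues j : ℂ) • c j) p.1 1
    rw [h2, adjoint_rightMulMatrix_apply_one, hcj]
    simp_rw [rightMulMatrix_apply_one, hcj]
    have h3 : (hM.eigenvalues j • ⇑(hM.eigenvectorBasis j)) p.1 =
      hM.eigenvalues j * hM.eigenvectorBasis j p.1 := by simp
    rw [← h3, ← h1]
    simp only [Matrix.mulVec, dotProduct, Matrix.map_apply, Matrix.mul_apply,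
      Matrix.transpose_apply, map_sum, map_mul, Finset.mul_sum, Finset.sum_mul]
    rw [Finset.sum_comm]
    simp [mul_assoc]
  rw [starProjection_spectralSubspace_eigenvector
    (ContinuousLinearMap.isPositive_adjoint_comp_self (rightMulMatrix A)).isSelfAdjoint hc]
  split_ifs
  · simp
  · simp

lemma trailingCoeff_map_of_injective {R S : Type*} [Semiring R] [Semiring S] {φ : R →+* S}
    (hφ : Function.Injective φ) (p : Polynomial R) :
    (p.map φ).trailingCoeff = φ p.trailingCoeff := by
  rw [Polynomial.trailingCoeff, Polynomial.trailingCoeff, Polynomial.coeff_map,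
    Polynomial.natTrailingDegree, Polynomial.natTrailingDegree, Polynomial.trailingDegree,
    Polynomial.trailingDegree, Polynomial.support_map_of_injective p hφ]

lemma trailingCoeff_prod {R ι : Type*} [CommRing R] [IsDomain R] (s : Finset ι)
    (p : ι → Polynomial R) : (∏ i ∈ s, p i).trailingCoeff = ∏ i ∈ s, (p i).trailingCoeff := by
  classical
  induction s using Finset.induction_on with
  | empty => simp [Polynomial.trailingCoeff]
  | insert a s ha ih =>
    rw [Finset.prod_insert ha, Finset.prod_insert ha, Polynomial.trailingCoeff_mul, ih]

lemma trailingCoeff_eq_coeff_zero {R : Type*} [Semiring R] {p : Polynomial R}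
    (h : p.coeff 0 ≠ 0) : p.trailingCoeff = p.coeff 0 := by
  rw [Polynomial.trailingCoeff, Polynomial.natTrailingDegree_eq_zero_of_constantCoeff_ne_zero]
  exact h

/-- The trailing coefficient treats a zero root as the determinant treats a zero eigenvalue: it
contributes 1. -/
lemma abs_trailingCoeff_X_sub_C (z : ℂ) :
    ‖(Polynomial.X - Polynomial.C z).trailingCoeff‖ = if z = 0 then 1 else ‖z‖ := by
  split_ifs with h
  · simp [h, Polynomial.trailingCoeff]
  · rw [trailingCoeff_eq_coeff_zero (by simpa using h)]
    simp

open scoped ComplexOrder in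
/-- Over the trivial group, the square of the determinant of an integral matrix `B` is the product
of the nonzero eigenvalues of `B Bᵀ`. -/
lemma fkDet_trivial_sq (A : Matrix (Fin r) (Fin s) (MonoidAlgebra ℤ E)) :
    fkDet (rightMulMatrix A) ^ 2 =
      |((intMatrix A * (intMatrix A).transpose).charpoly.trailingCoeff : ℝ)| := by
  set B := intMatrix A with hB
  have hpos : ((B * B.transpose).map (Int.castRingHom ℂ)).PosSemidef := by
    have := Matrix.posSemidef_self_mul_conjTranspose (B.map (Int.castRingHom ℂ))
    convert this using 1
    ext i j
    simp [Matrix.mul_apply]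
  have h1 := fkDet_eq_prod (rightMulMatrix A) hpos.1.eigenvalues hpos.eigenvalues_nonneg
    fun t ht => spectralDensity_trivial A hpos.1 ht
  have h2 : ‖(((B * B.transpose).charpoly.trailingCoeff : ℤ) : ℂ)‖ =
      ∏ i, if hpos.1.eigenvalues i = 0 then 1 else hpos.1.eigenvalues i := by
    -- The integral characteristic polynomial splits over `ℂ` into the factors `X - λ`, and trailing
    -- coefficients are multiplicative.
    have h3 := trailingCoeff_map_of_injective (φ := Int.castRingHom ℂ) Int.cast_injective
      (B * B.transpose).charpoly
    rw [← Matrix.charpoly_map, hpos.1.charpoly_eq, trailingCoeff_prod] at h3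
    change ‖(Int.castRingHom ℂ) _‖ = _
    rw [← h3, norm_prod]
    refine Finset.prod_congr rfl fun i _ => ?_
    rw [abs_trailingCoeff_X_sub_C]
    simp [abs_of_nonneg (hpos.eigenvalues_nonneg i)]
  rw [Complex.norm_intCast] at h2
  rw [h2, h1, ← Finset.prod_pow]
  refine Finset.prod_congr rfl fun i _ => ?_
  split_ifs
  · simp
  · rw [Real.sq_sqrt (hpos.eigenvalues_nonneg i)]

end Trivial

/-! ### Nonsingular integral matrices -/

lemma fkDet_nonneg {G : Type u} [Group G] {r s : ℕ} (f : L2Pow G r →L[ℂ] L2Pow G s) :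
    0 ≤ fkDet f := by
  unfold fkDet
  split_ifs
  · exact (Real.exp_pos _).le
  · exact le_rfl

lemma abs_trailingCoeff_charpoly {m : Type*} [Fintype m] [DecidableEq m] {M : Matrix m m ℤ}
    (h : M.det ≠ 0) : |M.charpoly.trailingCoeff| = |M.det| := by
  have h1 := M.det_eq_sign_charpoly_coeff
  have h2 : M.charpoly.coeff 0 ≠ 0 := fun h0 => h (by rw [h1, h0, mul_zero])
  rw [trailingCoeff_eq_coeff_zero h2, h1, abs_mul, abs_pow]
  simp

section Trivial

variable {E : Type u} [Group E] [Subsingleton E] {r : ℕ}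

lemma isWeakIso_trivial_iff (A : Matrix (Fin r) (Fin r) (MonoidAlgebra ℤ E)) :
    IsWeakIso (rightMulMatrix A) ↔ (intMatrix A).det ≠ 0 := by
  set B := (intMatrix A).map (Int.castRingHom ℂ) with hB
  have hdet : ∀ M : Matrix (Fin r) (Fin r) ℂ, Function.Injective M.mulVec ↔ M.det ≠ 0 := fun M => by
    rw [Matrix.mulVec_injective_iff_isUnit, Matrix.isUnit_iff_isUnit_det, isUnit_iff_ne_zero]
  have hBdet : B.det ≠ 0 ↔ (intMatrix A).det ≠ 0 := by
    rw [hB, ← RingHom.mapMatrix_apply, ← RingHom.map_det, eq_intCast, Int.cast_ne_zero]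
  let e : L2Pow E r ≃ (Fin r → ℂ) :=
    (unitBasis E r).repr.toEquiv.trans (WithLp.equiv 2 (Fin r → ℂ))
  have he : ∀ x i, e x i = x i 1 := unitBasis_repr_apply
  -- Applied to the operator, with matrix `Bᵀ`, and to its adjoint, with matrix `B`.
  have key : ∀ (f : L2Pow E r → L2Pow E r) (M : Matrix (Fin r) (Fin r) ℂ),
      (∀ x i, f x i 1 = M.mulVec (fun k => x k 1) i) → (Function.Injective f ↔ M.det ≠ 0) := by
    intro f M h
    have hf : f = e.symm ∘ M.mulVec ∘ e := by
      funext x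
      rw [Function.comp_apply, Function.comp_apply, Equiv.eq_symm_apply]
      funext i
      rw [he, h, ← funext (he x)]
    rw [← hdet, hf, e.symm.comp_injective, e.injective_comp]
  rw [isWeakIso_iff, key _ B.transpose, key _ B, Matrix.det_transpose, and_self, hBdet]
  · intro y i
    rw [adjoint_rightMulMatrix_apply_one]
    simp [Matrix.mulVec, dotProduct, hB]
  · intro x j
    rw [rightMulMatrix_apply_one]
    simp [Matrix.mulVec, dotProduct, hB]

/-- Over the trivial group, the determinant of a nonsingular matrix is the absolute value of its
classical determinant. -/
lemma fkDet_trivial_of_det_ne_zero (A : Matrix (Fin r) (Fin r) (MonoidAlgebra ℤ E))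
    (h : (intMatrix A).det ≠ 0) : fkDet (rightMulMatrix A) = |((intMatrix A).det : ℝ)| := by
  have h1 : (intMatrix A * (intMatrix A).transpose).det = (intMatrix A).det ^ 2 := by
    rw [Matrix.det_mul, Matrix.det_transpose, sq]
  rw [← abs_of_nonneg (fkDet_nonneg _), ← sq_eq_sq_iff_abs_eq_abs, fkDet_trivial_sq,
    ← Int.cast_abs, abs_trailingCoeff_charpoly (by rw [h1]; exact pow_ne_zero 2 h), h1]
  simp

end Trivial

/-! ### Finite groups -/

section Finite

variable {G : Type u} [Group G] {r s n : ℕ}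

/-- An enumeration of `G` is a system of coset representatives of the trivial subgroup, so the
restriction results apply. -/
lemma bijective_bot_mul {t : Fin n → G} (ht : t.Bijective) :
    Function.Bijective fun p : (⊥ : Subgroup G) × Fin n => (p.1 : G) * t p.2 := by
  have h : ∀ x : (⊥ : Subgroup G), (x : G) = 1 := fun x => Subgroup.mem_bot.1 x.2
  constructor
  · intro p q hpq
    simp only [h, one_mul] at hpq
    exact Prod.ext (Subsingleton.elim _ _) (ht.1 hpq)
  · intro g
    obtain ⟨k, hk⟩ := ht.2 g
    exact ⟨(1, k), by simpa using hk⟩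

/-- The integral matrix of `r_A^{(2)}` for a finite group with an enumeration `t`. -/
def regularMatrix (t : Fin n → G) (A : Matrix (Fin r) (Fin s) (MonoidAlgebra ℤ G)) :
    Matrix (Fin r × Fin n) (Fin s × Fin n) ℤ :=
  fun p q => (A p.1 q.1).coeff ((t p.2)⁻¹ * t q.2)

lemma intMatrix_restrictedMatrix (t : Fin n → G)
    (A : Matrix (Fin r) (Fin s) (MonoidAlgebra ℤ G)) :
    intMatrix (restrictedMatrix ⊥ t A) =
      (regularMatrix t A).submatrix finProdFinEquiv.symm finProdFinEquiv.symm := by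
  ext p q
  simp [intMatrix, restrictedMatrix, regularMatrix]

variable {t : Fin n → G}

lemma isWeakIso_iff_det_regularMatrix (ht : t.Bijective)
    (A : Matrix (Fin r) (Fin r) (MonoidAlgebra ℤ G)) :
    IsWeakIso (rightMulMatrix A) ↔ (regularMatrix t A).det ≠ 0 := by
  rw [isWeakIso_restrictedMatrix_iff (bijective_bot_mul ht), isWeakIso_trivial_iff,
    intMatrix_restrictedMatrix, Matrix.det_submatrix_equiv_self]

lemma fkDet_pow_of_det_ne_zero (hn : n ≠ 0) (ht : t.Bijective)
    (A : Matrix (Fin r) (Fin r) (MonoidAlgebra ℤ G)) (h : (regularMatrix t A).det ≠ 0) :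
    fkDet (rightMulMatrix A) ^ n = |((regularMatrix t A).det : ℝ)| := by
  have h1 : (intMatrix (restrictedMatrix ⊥ t A)).det = (regularMatrix t A).det := by
    rw [intMatrix_restrictedMatrix, Matrix.det_submatrix_equiv_self]
  rw [← fkDet_restrictedMatrix hn (bijective_bot_mul ht),
    fkDet_trivial_of_det_ne_zero _ (h1 ▸ h), h1]

lemma fkDet_pow_eq_trailingCoeff (hn : n ≠ 0) (ht : t.Bijective)
    (A : Matrix (Fin r) (Fin s) (MonoidAlgebra ℤ G)) :
    (fkDet (rightMulMatrix A) ^ n) ^ 2 =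
      |((regularMatrix t A * (regularMatrix t A).transpose).charpoly.trailingCoeff : ℝ)| := by
  rw [← fkDet_restrictedMatrix hn (bijective_bot_mul ht), fkDet_trivial_sq,
    intMatrix_restrictedMatrix, Matrix.transpose_submatrix, Matrix.submatrix_mul_equiv]
  have := Matrix.charpoly_reindex finProdFinEquiv
    (regularMatrix t A * (regularMatrix t A).transpose)
  rw [Matrix.reindex_apply] at this
  rw [this]

/-- The element `∑_{g ≠ 1} g` of the integral group ring of a finite group, as a matrix. -/
def augmentedNorm (G : Type u) [Group G] [Finite G] :
    Matrix (Fin 1) (Fin 1) (MonoidAlgebra ℤ G) :=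
  open scoped Classical in
  fun _ _ => .ofCoeff (Finsupp.equivFunOnFinite.symm fun g => if g = 1 then 0 else 1)

/-- With `J` the all-ones matrix, the regular matrix is `J - 1`, up to sign a rank one perturbation
of the identity with determinant `1 - n`. -/
lemma abs_det_regularMatrix_augmentedNorm [Finite G] (ht : t.Bijective) :
    |(regularMatrix t (augmentedNorm G)).det| = |(n : ℤ) - 1| := by
  have h : regularMatrix t (augmentedNorm G) = -(1 +
      Matrix.replicateCol Unit (fun _ : Fin 1 × Fin n => (-1 : ℤ)) *
        Matrix.replicateRow Unit fun _ : Fin 1 × Fin n => (1 : ℤ)) := by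
    ext p q
    have h1 : (t p.2)⁻¹ * t q.2 = 1 ↔ p = q := by
      rw [inv_mul_eq_one, ht.1.eq_iff, Prod.ext_iff]
      exact ⟨fun h => ⟨Subsingleton.elim _ _, h⟩, fun h => h.2⟩
    simp only [regularMatrix, augmentedNorm, Finsupp.equivFunOnFinite_symm_apply_apply, h1,
      Matrix.neg_apply, Matrix.add_apply, Matrix.one_apply, Matrix.mul_apply]
    by_cases hpq : p = q <;> simp [hpq]
  rw [h, Matrix.det_neg, Matrix.det_one_add_replicateCol_mul_replicateRow, abs_mul, abs_pow]
  simp [dotProduct, ← sub_eq_add_neg, abs_sub_comm]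

end Finite

/-! ### The group of order two -/

section OrderTwo

variable {C : Type u} [Group C] {r : ℕ}

/-- The enumeration of a group with at most one nontrivial element `τ`. -/
def pairEnum (τ : C) : Fin 2 → C := ![1, τ]

lemma exists_pairEnum_bijective (h : Nonempty (C ≃* Multiplicative (ZMod 2))) :
    ∃ τ : C, τ ≠ 1 ∧ τ * τ = 1 ∧ (pairEnum τ).Bijective := by
  obtain ⟨e⟩ := h
  have he : ∀ k, e.symm (Multiplicative.ofAdd (k : ZMod 2)) =
      pairEnum (e.symm (Multiplicative.ofAdd 1)) k := by
    intro k
    fin_cases k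
    · exact map_one e.symm
    · rfl
  refine ⟨e.symm (Multiplicative.ofAdd 1), ?_, ?_, ?_⟩
  · rw [Ne, map_eq_one_iff e.symm e.symm.injective]
    decide
  · rw [← map_mul, ← map_one e.symm]
    rfl
  · rw [← funext he]
    exact (Multiplicative.ofAdd.trans e.symm.toEquiv).bijective

/-- Conjugation by a unipotent block matrix makes the matrix block triangular, without dividing by
2. -/
lemma det_fromBlocks_circulant {m R : Type*} [Fintype m] [DecidableEq m] [CommRing R]
    (M N : Matrix m m R) :
    (Matrix.fromBlocks M N N M).det = (M + N).det * (M - N).det := by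
  have h : Matrix.fromBlocks 1 1 0 1 * Matrix.fromBlocks M N N M * Matrix.fromBlocks 1 (-1) 0 1 =
      Matrix.fromBlocks (M + N) 0 N (M - N) := by
    simp [Matrix.fromBlocks_multiply]
    constructor <;> abel
  have h2 := congrArg Matrix.det h
  simpa [Matrix.det_mul, Matrix.det_fromBlocks_zero₁₂, Matrix.det_fromBlocks_zero₂₁] using h2

/-- The two factors belong to the characters `τ ↦ 1` and `τ ↦ -1`. -/
lemma det_regularMatrix_pairEnum {τ : C} (hτ : τ * τ = 1)
    (A : Matrix (Fin r) (Fin r) (MonoidAlgebra ℤ C)) :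
    (regularMatrix (pairEnum τ) A).det =
      (A.map (fun a => a.coeff 1) + A.map fun a => a.coeff τ).det *
      (A.map (fun a => a.coeff 1) - A.map fun a => a.coeff τ).det := by
  have hinv : τ⁻¹ = τ := inv_eq_of_mul_eq_one_left hτ
  let e : Fin r ⊕ Fin r ≃ Fin r × Fin 2 :=
    { toFun := Sum.elim (fun i => (i, 0)) fun i => (i, 1)
      invFun := fun p => if p.2 = 0 then .inl p.1 else .inr p.1
      left_inv := by rintro (i | i) <;> simp
      right_inv := by
        rintro ⟨i, k⟩
        fin_cases k <;> simp }
  rw [← det_fromBlocks_circulant, ← Matrix.det_submatrix_equiv_self e]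
  congr 1
  ext p q
  rcases p with i | i <;> rcases q with j | j <;>
    simp [e, regularMatrix, pairEnum, hinv, hτ]

/-- The determinants of integral matrices which are congruent modulo two have equal parity. -/
lemma even_det_add_iff_even_det_sub {m : Type*} [Fintype m] [DecidableEq m]
    (M N : Matrix m m ℤ) : Even (M + N).det ↔ Even (M - N).det := by
  have h : ((M + N).det : ZMod 2) = (M - N).det := by
    have h1 : ∀ K : Matrix m m ℤ, (K.det : ZMod 2) = (K.map (Int.castRingHom (ZMod 2))).det :=
      fun K => (RingHom.map_det (Int.castRingHom (ZMod 2)) K)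
    rw [h1, h1]
    congr 1
    ext i j
    simp [CharTwo.sub_eq_add]
  rw [← ZMod.intCast_eq_zero_iff_even, ← ZMod.intCast_eq_zero_iff_even, h]

/-- If the product were `±2`, one factor and hence both would be even, and 4 would divide 2. -/
lemma three_le_abs_mul_of_parity {a b : ℤ} (h : Even a ↔ Even b) (h1 : 1 < |a * b|) :
    3 ≤ |a * b| := by
  by_contra h3
  have h2 : |a * b| = 2 := by omega
  have he : Even (a * b) := even_abs.1 (h2 ▸ even_two)
  have ha : Even a := by
    rcases Int.even_mul.1 he with h' | h'
    · exact h'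
    · exact h.2 h'
  obtain ⟨x, rfl⟩ := ha
  obtain ⟨y, rfl⟩ := h.1 ⟨x, rfl⟩
  have : (4 : ℤ) ∣ |(x + x) * (y + y)| := by
    rw [dvd_abs]
    exact ⟨x * y, by ring⟩
  rw [h2] at this
  norm_num at this

end OrderTwo

/-! ### Bounds for the Lehmer constants -/

section Bounds

variable {G : Type u} [Group G]

/-- Multiplication by 2, induced from the trivial subgroup, is admissible for all four constants. It
shows that the infima are over nonempty sets, and it bounds them by 2. -/
lemma exists_isWeakIso_fkDet_eq_two (G : Type u) [Group G] :
    ∃ A : Matrix (Fin 1) (Fin 1) (MonoidAlgebra ℤ G),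
      IsWeakIso (rightMulMatrix A) ∧ fkDet (rightMulMatrix A) = 2 := by
  let A : Matrix (Fin 1) (Fin 1) (MonoidAlgebra ℤ (⊥ : Subgroup G)) :=
    .of fun _ _ => .single 1 2
  have hA : (intMatrix A).det = 2 := by simp [A, intMatrix]
  have hφ := (⊥ : Subgroup G).subtype_injective
  refine ⟨inducedMatrix (⊥ : Subgroup G).subtype A, ?_, ?_⟩
  · rw [isWeakIso_inducedMatrix_iff hφ, isWeakIso_trivial_iff, hA]
    norm_num
  · rw [fkDet_inducedMatrix hφ, fkDet_trivial_of_det_ne_zero _ (by rw [hA]; norm_num), hA]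
    norm_num

lemma lehmer_le {r s : ℕ} (hr : 1 ≤ r) (hs : 1 ≤ s)
    (A : Matrix (Fin r) (Fin s) (MonoidAlgebra ℤ G)) (h : 1 < fkDet (rightMulMatrix A)) :
    lehmer G ≤ fkDet (rightMulMatrix A) :=
  csInf_le ⟨1, fun _ hd => hd.1.le⟩ ⟨h, r, s, hr, hs, A, rfl⟩

lemma lehmerOne_le (A : Matrix (Fin 1) (Fin 1) (MonoidAlgebra ℤ G))
    (h : 1 < fkDet (rightMulMatrix A)) : lehmerOne G ≤ fkDet (rightMulMatrix A) :=
  csInf_le ⟨1, fun _ hd => hd.1.le⟩ ⟨h, A, rfl⟩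

lemma lehmerWeak_le {r : ℕ} (hr : 1 ≤ r) (A : Matrix (Fin r) (Fin r) (MonoidAlgebra ℤ G))
    (hA : IsWeakIso (rightMulMatrix A)) (h : 1 < fkDet (rightMulMatrix A)) :
    lehmerWeak G ≤ fkDet (rightMulMatrix A) :=
  csInf_le ⟨1, fun _ hd => hd.1.le⟩ ⟨h, r, hr, A, hA, rfl⟩

lemma lehmerWeakOne_le (A : Matrix (Fin 1) (Fin 1) (MonoidAlgebra ℤ G))
    (hA : IsWeakIso (rightMulMatrix A)) (h : 1 < fkDet (rightMulMatrix A)) :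
    lehmerWeakOne G ≤ fkDet (rightMulMatrix A) :=
  csInf_le ⟨1, fun _ hd => hd.1.le⟩ ⟨h, A, hA, rfl⟩

/-- Nonemptiness matters: the real infimum of the empty set is `0` by convention. -/
lemma le_lehmer {b : ℝ} (h : ∀ (r s : ℕ), 1 ≤ r → 1 ≤ s →
    ∀ A : Matrix (Fin r) (Fin s) (MonoidAlgebra ℤ G), 1 < fkDet (rightMulMatrix A) →
      b ≤ fkDet (rightMulMatrix A)) : b ≤ lehmer G := by
  obtain ⟨A, -, hA⟩ := exists_isWeakIso_fkDet_eq_two G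
  refine le_csInf ⟨2, one_lt_two, 1, 1, le_rfl, le_rfl, A, hA⟩ ?_
  rintro _ ⟨hd, r, s, hr, hs, A, rfl⟩
  exact h r s hr hs A hd

lemma le_lehmerOne {b : ℝ} (h : ∀ A : Matrix (Fin 1) (Fin 1) (MonoidAlgebra ℤ G),
    1 < fkDet (rightMulMatrix A) → b ≤ fkDet (rightMulMatrix A)) : b ≤ lehmerOne G := by
  obtain ⟨A, -, hA⟩ := exists_isWeakIso_fkDet_eq_two G
  refine le_csInf ⟨2, one_lt_two, A, hA⟩ ?_
  rintro _ ⟨hd, A, rfl⟩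
  exact h A hd

lemma le_lehmerWeak {b : ℝ} (h : ∀ r : ℕ, 1 ≤ r →
    ∀ A : Matrix (Fin r) (Fin r) (MonoidAlgebra ℤ G), IsWeakIso (rightMulMatrix A) →
      1 < fkDet (rightMulMatrix A) → b ≤ fkDet (rightMulMatrix A)) : b ≤ lehmerWeak G := by
  obtain ⟨A, hw, hA⟩ := exists_isWeakIso_fkDet_eq_two G
  refine le_csInf ⟨2, one_lt_two, 1, le_rfl, A, hw, hA⟩ ?_
  rintro _ ⟨hd, r, hr, A, hw, rfl⟩
  exact h r hr A hw hd

lemma le_lehmerWeakOne {b : ℝ} (h : ∀ A : Matrix (Fin 1) (Fin 1) (MonoidAlgebra ℤ G),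
    IsWeakIso (rightMulMatrix A) → 1 < fkDet (rightMulMatrix A) →
      b ≤ fkDet (rightMulMatrix A)) : b ≤ lehmerWeakOne G := by
  obtain ⟨A, hw, hA⟩ := exists_isWeakIso_fkDet_eq_two G
  refine le_csInf ⟨2, one_lt_two, A, hw, hA⟩ ?_
  rintro _ ⟨hd, A, hw, rfl⟩
  exact h A hw hd

lemma lehmer_le_lehmerOne : lehmer G ≤ lehmerOne G :=
  le_lehmerOne fun A h => lehmer_le le_rfl le_rfl A h

lemma lehmerWeak_le_lehmerWeakOne : lehmerWeak G ≤ lehmerWeakOne G :=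
  le_lehmerWeakOne fun A hA h => lehmerWeak_le le_rfl A hA h

lemma lehmerOne_le_lehmerWeakOne : lehmerOne G ≤ lehmerWeakOne G :=
  le_lehmerWeakOne fun A _ h => lehmerOne_le A h

lemma lehmerWeakOne_le_two : lehmerWeakOne G ≤ 2 := by
  obtain ⟨A, hw, hA⟩ := exists_isWeakIso_fkDet_eq_two G
  rw [← hA]
  exact lehmerWeakOne_le A hw (by rw [hA]; exact one_lt_two)

lemma lehmer_nonneg : 0 ≤ lehmer G :=
  le_lehmer fun _ _ _ _ _ h => zero_le_one.trans h.le

lemma lehmerWeak_nonneg : 0 ≤ lehmerWeak G :=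
  le_lehmerWeak fun _ _ _ _ h => zero_le_one.trans h.le

end Bounds

/-! ### Subgroups -/

section Subgroup

variable {G : Type u} [Group G] (H : Subgroup G)

lemma lehmer_le_of_subgroup : lehmer G ≤ lehmer H := by
  refine le_lehmer fun r s hr hs A h => ?_
  rw [← fkDet_inducedMatrix H.subtype_injective] at h ⊢
  exact lehmer_le hr hs _ h

lemma lehmerOne_le_of_subgroup : lehmerOne G ≤ lehmerOne H := by
  refine le_lehmerOne fun A h => ?_
  rw [← fkDet_inducedMatrix H.subtype_injective] at h ⊢
  exact lehmerOne_le _ h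

lemma lehmerWeak_le_of_subgroup : lehmerWeak G ≤ lehmerWeak H := by
  refine le_lehmerWeak fun r hr A hA h => ?_
  rw [← fkDet_inducedMatrix H.subtype_injective] at h ⊢
  exact lehmerWeak_le hr _ ((isWeakIso_inducedMatrix_iff H.subtype_injective A).2 hA) h

lemma lehmerWeakOne_le_of_subgroup : lehmerWeakOne G ≤ lehmerWeakOne H := by
  refine le_lehmerWeakOne fun A hA h => ?_
  rw [← fkDet_inducedMatrix H.subtype_injective] at h ⊢
  exact lehmerWeakOne_le _ ((isWeakIso_inducedMatrix_iff H.subtype_injective A).2 hA) h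

/-- Restriction to `H` takes the determinant to its power with exponent `H.index`, but also enlarges
the matrix by that factor. Hence this argument does not cover the constants for `(1,1)`-matrices. -/
lemma lehmer_rpow_inv_index_le [H.FiniteIndex] :
    lehmer H ^ ((H.index : ℝ)⁻¹) ≤ lehmer G := by
  obtain ⟨t, ht⟩ := exists_transversal H
  have hn : H.index ≠ 0 := Subgroup.FiniteIndex.index_ne_zero
  refine le_lehmer fun r s hr hs A h => ?_
  have h1 := fkDet_restrictedMatrix hn ht A
  rw [Real.rpow_inv_le_iff_of_pos lehmer_nonneg (fkDet_nonneg _) (by positivity),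
    Real.rpow_natCast, ← h1]
  refine lehmer_le (Nat.mul_pos hr (Nat.pos_of_ne_zero hn))
    (Nat.mul_pos hs (Nat.pos_of_ne_zero hn)) _ ?_
  rw [h1]
  exact one_lt_pow₀ h hn

lemma lehmerWeak_rpow_inv_index_le [H.FiniteIndex] :
    lehmerWeak H ^ ((H.index : ℝ)⁻¹) ≤ lehmerWeak G := by
  obtain ⟨t, ht⟩ := exists_transversal H
  have hn : H.index ≠ 0 := Subgroup.FiniteIndex.index_ne_zero
  refine le_lehmerWeak fun r hr A hA h => ?_
  have h1 := fkDet_restrictedMatrix hn ht A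
  rw [Real.rpow_inv_le_iff_of_pos lehmerWeak_nonneg (fkDet_nonneg _) (by positivity),
    Real.rpow_natCast, ← h1]
  refine lehmerWeak_le (Nat.mul_pos hr (Nat.pos_of_ne_zero hn)) _
    ((isWeakIso_restrictedMatrix_iff ht A).1 hA) ?_
  rw [h1]
  exact one_lt_pow₀ h hn

end Subgroup

/-! ### Finitely generated subgroups -/

section FinitelyGenerated

variable (G : Type u) [Group G]

lemma isGLB_lehmer : IsGLB {x : ℝ | ∃ H : Subgroup G, H.FG ∧ x = lehmer H} (lehmer G) := by
  refine ⟨?_, fun b hb => le_lehmer fun r s hr hs A h => ?_⟩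
  · rintro _ ⟨H, -, rfl⟩
    exact lehmer_le_of_subgroup H
  · obtain ⟨H, hH, B, rfl⟩ := exists_fg_inducedMatrix A
    rw [fkDet_inducedMatrix H.subtype_injective] at h ⊢
    exact (hb ⟨H, hH, rfl⟩).trans (lehmer_le hr hs B h)

lemma isGLB_lehmerOne :
    IsGLB {x : ℝ | ∃ H : Subgroup G, H.FG ∧ x = lehmerOne H} (lehmerOne G) := by
  refine ⟨?_, fun b hb => le_lehmerOne fun A h => ?_⟩
  · rintro _ ⟨H, -, rfl⟩
    exact lehmerOne_le_of_subgroup H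
  · obtain ⟨H, hH, B, rfl⟩ := exists_fg_inducedMatrix A
    rw [fkDet_inducedMatrix H.subtype_injective] at h ⊢
    exact (hb ⟨H, hH, rfl⟩).trans (lehmerOne_le B h)

lemma isGLB_lehmerWeak :
    IsGLB {x : ℝ | ∃ H : Subgroup G, H.FG ∧ x = lehmerWeak H} (lehmerWeak G) := by
  refine ⟨?_, fun b hb => le_lehmerWeak fun r hr A hA h => ?_⟩
  · rintro _ ⟨H, -, rfl⟩
    exact lehmerWeak_le_of_subgroup H
  · obtain ⟨H, hH, B, rfl⟩ := exists_fg_inducedMatrix A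
    rw [fkDet_inducedMatrix H.subtype_injective] at h ⊢
    rw [isWeakIso_inducedMatrix_iff H.subtype_injective] at hA
    exact (hb ⟨H, hH, rfl⟩).trans (lehmerWeak_le hr B hA h)

lemma isGLB_lehmerWeakOne :
    IsGLB {x : ℝ | ∃ H : Subgroup G, H.FG ∧ x = lehmerWeakOne H} (lehmerWeakOne G) := by
  refine ⟨?_, fun b hb => le_lehmerWeakOne fun A hA h => ?_⟩
  · rintro _ ⟨H, -, rfl⟩
    exact lehmerWeakOne_le_of_subgroup H
  · obtain ⟨H, hH, B, rfl⟩ := exists_fg_inducedMatrix A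
    rw [fkDet_inducedMatrix H.subtype_injective] at h ⊢
    rw [isWeakIso_inducedMatrix_iff H.subtype_injective] at hA
    exact (hb ⟨H, hH, rfl⟩).trans (lehmerWeakOne_le B hA h)

end FinitelyGenerated

/-! ### The Lehmer constants of the trivial group -/

section Trivial

variable (E : Type u) [Group E] [Subsingleton E]

lemma two_le_abs_of_one_lt {z : ℤ} (h : (1 : ℝ) < |(z : ℝ)|) : (2 : ℝ) ≤ |(z : ℝ)| := by
  rw [← Int.cast_abs] at h ⊢
  exact_mod_cast (show (2 : ℤ) ≤ |z| from by exact_mod_cast h)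

/-- The squared determinant is an integer greater than 1. -/
lemma sqrt_two_le_lehmer : √2 ≤ lehmer E := by
  refine le_lehmer fun r s _ _ A h => ?_
  rw [Real.sqrt_le_left (fkDet_nonneg _), fkDet_trivial_sq]
  refine two_le_abs_of_one_lt ?_
  rw [← fkDet_trivial_sq]
  exact one_lt_pow₀ h two_ne_zero

lemma lehmer_le_sqrt_two : lehmer E ≤ √2 := by
  -- The row `B = (1 1)` has `B Bᵀ = (2)`.
  let A : Matrix (Fin 1) (Fin 2) (MonoidAlgebra ℤ E) := .of fun _ _ => .single 1 1
  have hA : (intMatrix A * (intMatrix A).transpose).det = 2 := by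
    simp [A, intMatrix, Matrix.mul_apply]
  have h2 : fkDet (rightMulMatrix A) = √2 := by
    rw [eq_comm, Real.sqrt_eq_iff_eq_sq (by norm_num) (fkDet_nonneg _), fkDet_trivial_sq,
      ← Int.cast_abs, abs_trailingCoeff_charpoly (by rw [hA]; norm_num), hA]
    norm_num
  rw [← h2]
  refine lehmer_le le_rfl (by norm_num) A ?_
  rw [h2]
  exact Real.one_lt_sqrt_two

lemma two_le_lehmerOne : 2 ≤ lehmerOne E := by
  refine le_lehmerOne fun A h => ?_
  by_cases hA : (intMatrix A).det = 0
  -- A singular `(1,1)`-matrix is zero. Its characteristic polynomial is `X`, so its determinant is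
  -- 1 and it does not compete.
  · have h0 : intMatrix A = 0 := by
      ext i j
      rw [Matrix.det_fin_one] at hA
      rw [Subsingleton.elim i 0, Subsingleton.elim j 0, hA]
      rfl
    have h1 := fkDet_trivial_sq A
    rw [h0, Matrix.zero_mul, Matrix.charpoly_zero] at h1
    have h2 := one_lt_pow₀ h two_ne_zero
    rw [h1] at h2
    simp [Polynomial.trailingCoeff] at h2
  · rw [fkDet_trivial_of_det_ne_zero A hA] at h ⊢
    exact two_le_abs_of_one_lt h

lemma two_le_lehmerWeak : 2 ≤ lehmerWeak E := by
  refine le_lehmerWeak fun r _ A hA h => ?_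
  rw [fkDet_trivial_of_det_ne_zero A ((isWeakIso_trivial_iff A).1 hA)] at h ⊢
  exact two_le_abs_of_one_lt h

end Trivial

/-! ### The Lehmer constants of finite groups -/

section Finite

variable (G : Type u) [Group G] [Finite G]

lemma two_rpow_inv_card_le_lehmerWeak : (2 : ℝ) ^ ((Nat.card G : ℝ)⁻¹) ≤ lehmerWeak G := by
  refine le_trans ?_ (lehmerWeak_rpow_inv_index_le (⊥ : Subgroup G))
  rw [Subgroup.index_bot]
  exact Real.rpow_le_rpow zero_le_two (two_le_lehmerWeak _) (by positivity)

lemma two_rpow_inv_two_mul_card_le_lehmer :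
    (2 : ℝ) ^ ((2 * (Nat.card G : ℝ))⁻¹) ≤ lehmer G := by
  refine le_trans ?_ (lehmer_rpow_inv_index_le (⊥ : Subgroup G))
  rw [Subgroup.index_bot, mul_inv, Real.rpow_mul zero_le_two, ← one_div, ← Real.sqrt_eq_rpow]
  exact Real.rpow_le_rpow (Real.sqrt_nonneg _) (sqrt_two_le_lehmer _) (by positivity)

lemma lehmerWeakOne_le_rpow_inv_card (h3 : 3 ≤ Nat.card G) :
    lehmerWeakOne G ≤ ((Nat.card G : ℝ) - 1) ^ ((Nat.card G : ℝ)⁻¹) := by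
  obtain ⟨n, hn⟩ : ∃ n, n = Nat.card G := ⟨_, rfl⟩
  let t : Fin n ≃ G := (Finite.equivFinOfCardEq hn.symm).symm
  rw [← hn] at h3 ⊢
  have h3' : (3 : ℝ) ≤ n := by exact_mod_cast h3
  have hn0 : n ≠ 0 := by omega
  have h1 := abs_det_regularMatrix_augmentedNorm t.bijective
  have hne : (regularMatrix t (augmentedNorm G)).det ≠ 0 := by
    rw [← abs_pos, h1, abs_pos]
    omega
  have h2 := fkDet_pow_of_det_ne_zero hn0 t.bijective _ hne
  rw [← Int.cast_abs, h1, Int.cast_abs] at h2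
  push_cast at h2
  rw [abs_of_pos (by linarith)] at h2
  have h4 : fkDet (rightMulMatrix (augmentedNorm G)) = ((n : ℝ) - 1) ^ ((n : ℝ)⁻¹) := by
    rw [← h2, Real.pow_rpow_inv_natCast (fkDet_nonneg _) hn0]
  rw [← h4]
  refine lehmerWeakOne_le _ ((isWeakIso_iff_det_regularMatrix t.bijective _).2 hne) ?_
  rw [h4]
  -- Here `|G| ≥ 3` is essential: it gives `|G| - 1 > 1`.
  exact Real.one_lt_rpow (by linarith) (by positivity)

end Finite

/-! ### The Lehmer constants of the group of order two -/

section OrderTwo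

variable {C : Type u} [Group C]

lemma sqrt_three_le_lehmerWeak (hC : Nonempty (C ≃* Multiplicative (ZMod 2))) :
    √3 ≤ lehmerWeak C := by
  obtain ⟨τ, -, hτ, ht⟩ := exists_pairEnum_bijective hC
  refine le_lehmerWeak fun r _ A hA h => ?_
  have hdet := (isWeakIso_iff_det_regularMatrix ht A).1 hA
  have h1 := one_lt_pow₀ h two_ne_zero
  rw [Real.sqrt_le_left (fkDet_nonneg _)]
  rw [fkDet_pow_of_det_ne_zero two_ne_zero ht A hdet, det_regularMatrix_pairEnum hτ,
    ← Int.cast_abs] at h1 ⊢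
  exact_mod_cast three_le_abs_mul_of_parity (even_det_add_iff_even_det_sub _ _)
    (by exact_mod_cast h1)

lemma lehmerWeakOne_le_sqrt_three (hC : Nonempty (C ≃* Multiplicative (ZMod 2))) :
    lehmerWeakOne C ≤ √3 := by
  obtain ⟨τ, hτ1, hτ, ht⟩ := exists_pairEnum_bijective hC
  -- The element `2 + τ` takes the values 3 and 1 at the two characters.
  let A : Matrix (Fin 1) (Fin 1) (MonoidAlgebra ℤ C) := .of fun _ _ => .single 1 2 + .single τ 1
  have hdet : (regularMatrix (pairEnum τ) A).det = 3 := by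
    rw [det_regularMatrix_pairEnum hτ, Matrix.det_fin_one, Matrix.det_fin_one]
    simp [A, hτ1, hτ1.symm]
  have hne : (regularMatrix (pairEnum τ) A).det ≠ 0 := by rw [hdet]; norm_num
  have h3 : fkDet (rightMulMatrix A) = √3 := by
    rw [eq_comm, Real.sqrt_eq_iff_eq_sq (by norm_num) (fkDet_nonneg _),
      fkDet_pow_of_det_ne_zero two_ne_zero ht A hne, hdet]
    norm_num
  rw [← h3]
  refine lehmerWeakOne_le A ((isWeakIso_iff_det_regularMatrix ht A).2 hne) ?_
  rw [h3, Real.lt_sqrt zero_le_one]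
  norm_num

lemma trailingCoeff_X_sq_sub {T : ℤ} (hT : T ≠ 0) :
    (Polynomial.X ^ 2 - Polynomial.C T * Polynomial.X).trailingCoeff = -T := by
  have h : (Polynomial.X ^ 2 - Polynomial.C T * Polynomial.X : Polynomial ℤ) =
      (Polynomial.X - Polynomial.C T) * Polynomial.X := by ring
  rw [h, Polynomial.trailingCoeff_mul, trailingCoeff_eq_coeff_zero (by simpa using hT)]
  simp [Polynomial.trailingCoeff]

/-- Singularity forces the coefficients at `1` and `τ` to agree up to sign. The characteristic
polynomial of `B Bᵀ` is then `X² - T X`, where the trace `T`, the sum of the squares of the four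
entries of `B`, is four times one square. If `T = 0` the trailing coefficient is 1. -/
lemma fkDet_pow_four_of_det_eq_zero {τ : C} (hτ : τ * τ = 1) (ht : (pairEnum τ).Bijective)
    (A : Matrix (Fin 1) (Fin 1) (MonoidAlgebra ℤ C))
    (hdet : (regularMatrix (pairEnum τ) A).det = 0) :
    (fkDet (rightMulMatrix A) ^ 2) ^ 2 =
      if (A 0 0).coeff 1 = 0 then 1 else 4 * ((A 0 0).coeff 1 : ℝ) ^ 2 := by
  have hinv : τ⁻¹ = τ := inv_eq_of_mul_eq_one_left hτ
  rw [fkDet_pow_eq_trailingCoeff two_ne_zero ht, Matrix.charpoly_of_card_eq_two _ (by simp),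
    Matrix.det_mul, hdet, zero_mul, map_zero, add_zero]
  have hab : (A 0 0).coeff τ ^ 2 = (A 0 0).coeff 1 ^ 2 := by
    rw [det_regularMatrix_pairEnum hτ, Matrix.det_fin_one, Matrix.det_fin_one] at hdet
    simp only [Matrix.add_apply, Matrix.sub_apply, Matrix.map_apply] at hdet
    linear_combination -hdet
  have htr : (regularMatrix (pairEnum τ) A * (regularMatrix (pairEnum τ) A).transpose).trace =
      4 * (A 0 0).coeff 1 ^ 2 := by
    simp only [Matrix.trace, Matrix.diag_apply, Matrix.mul_apply, Matrix.transpose_apply,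
      Fintype.sum_prod_type, Fin.sum_univ_two, Finset.univ_unique, Finset.sum_singleton,
      regularMatrix, pairEnum, Matrix.cons_val_zero, Matrix.cons_val_one, inv_one, one_mul,
      mul_one, hinv, hτ, Fin.default_eq_zero, Fin.isValue]
    linear_combination 2 * hab
  rw [htr]
  split_ifs with h0
  · simp [h0, Polynomial.trailingCoeff]
  · rw [trailingCoeff_X_sq_sub (by positivity)]
    push_cast
    rw [abs_neg, abs_of_nonneg (by positivity)]

/-- In the singular case the fourth power of the determinant is at least 4; otherwise its square is
an integer greater than 1. -/
lemma sqrt_two_le_lehmerOne (hC : Nonempty (C ≃* Multiplicative (ZMod 2))) :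
    √2 ≤ lehmerOne C := by
  obtain ⟨τ, -, hτ, ht⟩ := exists_pairEnum_bijective hC
  refine le_lehmerOne fun A h => ?_
  have h1 := one_lt_pow₀ h two_ne_zero
  rw [Real.sqrt_le_left (fkDet_nonneg _)]
  by_cases hdet : (regularMatrix (pairEnum τ) A).det = 0
  · have h2 := fkDet_pow_four_of_det_eq_zero hτ ht A hdet
    have h3 := one_lt_pow₀ h1 two_ne_zero
    split_ifs at h2 with h0
    · exact absurd h2 h3.ne'
    · have h4 : (1 : ℝ) ≤ ((A 0 0).coeff 1 : ℝ) ^ 2 := by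
        exact_mod_cast Int.one_le_abs (pow_ne_zero 2 h0) |>.trans_eq (abs_sq _)
      refine le_of_sq_le_sq ?_ (by positivity)
      rw [h2]
      linarith
  · rw [fkDet_pow_of_det_ne_zero two_ne_zero ht A hdet] at h1 ⊢
    exact two_le_abs_of_one_lt h1

lemma lehmerOne_le_sqrt_two (hC : Nonempty (C ≃* Multiplicative (ZMod 2))) :
    lehmerOne C ≤ √2 := by
  obtain ⟨τ, hτ1, hτ, ht⟩ := exists_pairEnum_bijective hC
  -- The element `1 + τ` is a zero divisor, which attains the bound of the singular case.
  let A : Matrix (Fin 1) (Fin 1) (MonoidAlgebra ℤ C) := .of fun _ _ => .single 1 1 + .single τ 1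
  have hdet : (regularMatrix (pairEnum τ) A).det = 0 := by
    rw [det_regularMatrix_pairEnum hτ, Matrix.det_fin_one, Matrix.det_fin_one]
    simp [A, hτ1, hτ1.symm]
  have h2 : fkDet (rightMulMatrix A) = √2 := by
    have h4 := fkDet_pow_four_of_det_eq_zero hτ ht A hdet
    have hA : (A 0 0).coeff 1 = 1 := by simp [A, hτ1]
    rw [hA, if_neg one_ne_zero, show 4 * ((1 : ℤ) : ℝ) ^ 2 = 2 ^ 2 by norm_num,
      pow_left_inj₀ (by positivity) zero_le_two two_ne_zero] at h4
    rw [eq_comm, Real.sqrt_eq_iff_eq_sq (by norm_num) (fkDet_nonneg _), h4]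
  rw [← h2]
  refine lehmerOne_le A ?_
  rw [h2]
  exact Real.one_lt_sqrt_two

lemma card_eq_two_of_mulEquiv (hC : Nonempty (C ≃* Multiplicative (ZMod 2))) :
    Nat.card C = 2 := by
  obtain ⟨e⟩ := hC
  rw [Nat.card_congr e.toEquiv]
  exact Nat.card_zmod 2

end OrderTwo

end Lehmer

end

theorem lemma5p1 :
    -- subgroups
    (∀ (G : Type u) [Group G] (H : Subgroup G),
      Lehmer.lehmer G ≤ Lehmer.lehmer H ∧
      Lehmer.lehmerOne G ≤ Lehmer.lehmerOne H ∧
      Lehmer.lehmerWeak G ≤ Lehmer.lehmerWeak H ∧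
      Lehmer.lehmerWeakOne G ≤ Lehmer.lehmerWeakOne H) ∧
    -- subgroups of finite index
    (∀ (G : Type u) [Group G] (H : Subgroup G), H.FiniteIndex →
      Lehmer.lehmer H ^ ((H.index : ℝ)⁻¹) ≤ Lehmer.lehmer G ∧
      Lehmer.lehmerWeak H ^ ((H.index : ℝ)⁻¹) ≤ Lehmer.lehmerWeak G) ∧
    -- the trivial group
    (∀ (E : Type u) [Group E], Subsingleton E →
      Lehmer.lehmerOne E = 2 ∧ Lehmer.lehmerWeak E = 2 ∧ Lehmer.lehmerWeakOne E = 2 ∧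
      Lehmer.lehmer E = √2) ∧
    -- the group of order two
    (∀ (C : Type u) [Group C], Nonempty (C ≃* Multiplicative (ZMod 2)) →
      Lehmer.lehmerWeak C = √3 ∧ Lehmer.lehmerWeakOne C = √3 ∧
      Lehmer.lehmerOne C = √2 ∧
      (2 : ℝ) ^ (1 / 4 : ℝ) ≤ Lehmer.lehmer C ∧ Lehmer.lehmer C ≤ √2) ∧
    -- finite groups of order at least three
    (∀ (G : Type u) [Group G], Finite G → 3 ≤ Nat.card G →
      ((2 : ℝ) ^ ((Nat.card G : ℝ)⁻¹) ≤ Lehmer.lehmerWeak G ∧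
        Lehmer.lehmerWeak G ≤ Lehmer.lehmerWeakOne G ∧
        Lehmer.lehmerWeakOne G ≤ ((Nat.card G : ℝ) - 1) ^ ((Nat.card G : ℝ)⁻¹)) ∧
      ((2 : ℝ) ^ ((2 * (Nat.card G : ℝ))⁻¹) ≤ Lehmer.lehmer G ∧
        Lehmer.lehmer G ≤ Lehmer.lehmerOne G ∧
        Lehmer.lehmerOne G ≤ ((Nat.card G : ℝ) - 1) ^ ((Nat.card G : ℝ)⁻¹))) ∧
    -- finitely generated subgroups
    (∀ (G : Type u) [Group G],
      IsGLB {x : ℝ | ∃ H : Subgroup G, H.FG ∧ x = Lehmer.lehmer H} (Lehmer.lehmer G) ∧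
      IsGLB {x : ℝ | ∃ H : Subgroup G, H.FG ∧ x = Lehmer.lehmerOne H} (Lehmer.lehmerOne G) ∧
      IsGLB {x : ℝ | ∃ H : Subgroup G, H.FG ∧ x = Lehmer.lehmerWeak H} (Lehmer.lehmerWeak G) ∧
      IsGLB {x : ℝ | ∃ H : Subgroup G, H.FG ∧ x = Lehmer.lehmerWeakOne H}
        (Lehmer.lehmerWeakOne G)) := by
  refine ⟨fun G _ H => ⟨Lehmer.lehmer_le_of_subgroup H, Lehmer.lehmerOne_le_of_subgroup H,
      Lehmer.lehmerWeak_le_of_subgroup H, Lehmer.lehmerWeakOne_le_of_subgroup H⟩,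
    fun G _ H _ => ⟨Lehmer.lehmer_rpow_inv_index_le H, Lehmer.lehmerWeak_rpow_inv_index_le H⟩,
    fun E _ _ => ?_, fun C _ hC => ?_, fun G _ _ h3 => ?_,
    fun G _ => ⟨Lehmer.isGLB_lehmer G, Lehmer.isGLB_lehmerOne G, Lehmer.isGLB_lehmerWeak G,
      Lehmer.isGLB_lehmerWeakOne G⟩⟩
  · have h2 := Lehmer.lehmerWeakOne_le_two (G := E)
    have hw := Lehmer.lehmerWeak_le_lehmerWeakOne (G := E)
    have h1 := Lehmer.lehmerOne_le_lehmerWeakOne (G := E)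
    exact ⟨(h1.trans h2).antisymm (Lehmer.two_le_lehmerOne E),
      (hw.trans h2).antisymm (Lehmer.two_le_lehmerWeak E),
      h2.antisymm ((Lehmer.two_le_lehmerWeak E).trans hw),
      (Lehmer.lehmer_le_sqrt_two E).antisymm (Lehmer.sqrt_two_le_lehmer E)⟩
  · have hw := Lehmer.lehmerWeak_le_lehmerWeakOne (G := C)
    have h3 := Lehmer.sqrt_three_le_lehmerWeak hC
    have h3' := Lehmer.lehmerWeakOne_le_sqrt_three hC
    have h2 := Lehmer.lehmerOne_le_sqrt_two hC
    have hcard := Lehmer.card_eq_two_of_mulEquiv hC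
    have : Finite C := Nat.finite_of_card_ne_zero (by rw [hcard]; norm_num)
    -- The general bound for finite groups has exponent `(2 * 2)⁻¹ = 1 / 4` here.
    have h4 := Lehmer.two_rpow_inv_two_mul_card_le_lehmer C
    rw [hcard] at h4
    norm_num at h4
    norm_num
    exact ⟨(hw.trans h3').antisymm h3, h3'.antisymm (h3.trans hw),
      h2.antisymm (Lehmer.sqrt_two_le_lehmerOne hC), h4,
      Lehmer.lehmer_le_lehmerOne.trans h2⟩
  · have h1 := Lehmer.lehmerWeakOne_le_rpow_inv_card G h3
    exact ⟨⟨Lehmer.two_rpow_inv_card_le_lehmerWeak G, Lehmer.lehmerWeak_le_lehmerWeakOne, h1⟩,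
      Lehmer.two_rpow_inv_two_mul_card_le_lehmer G, Lehmer.lehmer_le_lehmerOne,
      Lehmer.lehmerOne_le_lehmerWeakOne.trans h1⟩
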